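/- Let $P=(p_1,\dots,p_n)\in\mathbb R^{d\times n}$ be a projection matrix: its columns are $\mathbb Q$-linearly independent and $\operatorname{rank}_{\mathbb R}P=d$. Let $\mathbb T^n=(\mathbb R/2\pi\mathbb Z)^n$, let $\mathcal A$ be a continuous function on $\mathbb T^n$ with values in the real $d\times d$ matrices, and let $\alpha(x)=\mathcal A(P^Tx)$, $x\in\mathbb R^d$, be the quasiperiodic coefficient with parent function $\mathcal A$. Assume that $\alpha(x)$ is symmetric for every $x$ and that there are constants $C_0,C_1>0$ with $$C_0|\xi|^2\le \xi^T\alpha(x)\xi\le C_1|\xi|^2\qquad\text{for all }x,\xi\in\mathbb R^d$$ (a scalar coefficient is the case where $\alpha$ is a multiple of the identity). Let $(F,G)=|\mathbb T^n|^{-1}\int_{\mathbb T^n}F\overline G\,dy$ be the inner product of the complex space $L^2(\mathbb T^n)$, and let $V=H^1_P(\mathbb T^n)=\{U\in L^2(\mathbb T^n): P\nabla U\in L^2(\mathbb T^n)^d\}$, with $P\nabla U$ taken in the weak sense and with the inner product $(U,W)+(P\nabla U,P\nabla W)$. On $V$ put $$a(U,W)=(\mathcal A\,P\nabla U,P\nabla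 W)+(U,W).$$ For $N\ge 1$ let $V^N=\operatorname{span}\{e^{ik^Ty}: k\in\mathbb Z^n,\ -N/2\le k_j<N/2\ (1\le j\le n)\}$, let $$(F,G)_N=N^{-n}\sum_{j\in\{0,\dots,N-1\}^n}F(y_j)\overline{G(y_j)},\qquad y_j=\tfrac{2\pi}{N}(j_1,\dots,j_n),$$ and put $a_p(U,W)=(\mathcal A\,P\nabla U,P\nabla W)_N+(U,W)_N$ on $V^N$. Then there is exactly one bounded linear operator $K:V\to V$ with $a(KF,W)=(F,W)$ for all $F,W\in V$, and for every $N\ge1$ there is exactly one linear operator $K_N:V^N\to V^N$ with $a_p(K_NF,W)=(F,W)_N$ for all $F,W\in V^N$. Moreover every point of the spectrum of $K$ is approximated by the spectra of the $K_N$: $$\lim_{N\to\infty}\operatorname{dist}\bigl(\gamma,\sigma(K_N)\bigr)=0\qquad\text{for all }\gamma\in\sigma(K).$$ -/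

import Mathlib

open MeasureTheory Filter Topology Matrix
open scoped ContDiff ComplexConjugate Real

noncomputable section

namespace QEO

instance fact_two_pi_pos : Fact (0 < 2 * π) := ⟨Real.two_pi_pos⟩

/-- A projection matrix: its columns are linearly independent over `ℚ` and it has real rank `d`. -/
def IsProjectionMatrix {d n : ℕ} (P : Matrix (Fin d) (Fin n) ℝ) : Prop :=
  LinearIndependent ℚ (fun i : Fin n => (fun j : Fin d => P j i)) ∧ P.rank = d

/-- The torus `(ℝ / 2πℤ)ⁿ`. -/
abbrev Torus (n : ℕ) : Type := Fin n → AddCircle (2 * π)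

/-- The quotient map `ℝⁿ → (ℝ / 2πℤ)ⁿ`. -/
def toTorus {n : ℕ} (x : Fin n → ℝ) : Torus n := fun i => (x i : AddCircle (2 * π))

/-- The normalised measure `|𝕋ⁿ|⁻¹ dy`. -/
abbrev torusMeasure (n : ℕ) : Measure (Torus n) :=
  Measure.pi fun _ : Fin n => AddCircle.haarAddCircle (T := 2 * π)

/-- The Hilbert space `L²(𝕋ⁿ)` for the normalised measure. -/
abbrev L2 (n : ℕ) : Type := Lp ℂ 2 (torusMeasure n)

/-! ### Derivatives on the torus -/

/-- The `i`-th partial derivative of a function on the torus. -/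
def partialDeriv {n : ℕ} (φ : Torus n → ℂ) (i : Fin n) (y : Torus n) : ℂ :=
  deriv (fun t : ℝ => φ (y + toTorus (Pi.single i t))) 0

/-- The classical `P∇φ`, a function with values in `ℂᵈ`. -/
def projGrad {d n : ℕ} (P : Matrix (Fin d) (Fin n) ℝ) (φ : Torus n → ℂ) (y : Torus n) :
    Fin d → ℂ :=
  fun j => ∑ i, (P j i : ℂ) * partialDeriv φ i y

/-- Smooth functions on the torus, i.e. smooth functions on `ℝⁿ` that are `2π`-periodic in
each variable. -/
def IsTestFunction {n : ℕ} (φ : Torus n → ℂ) : Prop :=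
  ContDiff ℝ ∞ (fun x : Fin n → ℝ => φ (toTorus x))

/-- `W` is the weak `P∇U`: integration by parts holds against every smooth test function. -/
def IsWeakProjGrad {d n : ℕ} (P : Matrix (Fin d) (Fin n) ℝ) (U : L2 n) (W : Fin d → L2 n) :
    Prop :=
  ∀ φ : Torus n → ℂ, IsTestFunction φ → ∀ j : Fin d,
    ∫ y, W j y * φ y ∂(torusMeasure n) = - ∫ y, U y * projGrad P φ y j ∂(torusMeasure n)

/-! ### Helper facts: test functions and their derivatives are continuous -/

theorem toTorus_add {n : ℕ} (x z : Fin n → ℝ) : toTorus (x + z) = toTorus x + toTorus z := by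
  funext i
  simp [toTorus]

theorem isOpenQuotientMap_toTorus (n : ℕ) :
    IsOpenQuotientMap (toTorus : (Fin n → ℝ) → Torus n) := by
  have h : IsOpenQuotientMap (fun t : ℝ => (t : AddCircle (2 * π))) :=
    QuotientAddGroup.isOpenQuotientMap_mk
  exact IsOpenQuotientMap.piMap (fun _ => h)

theorem IsTestFunction.continuous {n : ℕ} {φ : Torus n → ℂ} (h : IsTestFunction φ) :
    Continuous φ :=
  (isOpenQuotientMap_toTorus n).isQuotientMap.continuous_iff.2 (ContDiff.continuous h)

theorem partialDeriv_toTorus {n : ℕ} {φ : Torus n → ℂ} (h : IsTestFunction φ) (i : Fin n)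
    (x : Fin n → ℝ) :
    partialDeriv φ i (toTorus x)
      = fderiv ℝ (fun x : Fin n → ℝ => φ (toTorus x)) x (Pi.single i 1) := by
  have hd : DifferentiableAt ℝ (fun x : Fin n → ℝ => φ (toTorus x)) x :=
    (ContDiff.differentiable h (by simp)) x
  rw [← hd.lineDeriv_eq_fderiv]
  unfold partialDeriv lineDeriv
  congr 1
  funext t
  rw [← toTorus_add]
  congr 3
  funext k
  by_cases hk : k = i
  · subst hk; simp
  · simp [hk]

theorem IsTestFunction.continuous_partialDeriv {n : ℕ} {φ : Torus n → ℂ} (h : IsTestFunction φ)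
    (i : Fin n) : Continuous (partialDeriv φ i) := by
  refine (isOpenQuotientMap_toTorus n).isQuotientMap.continuous_iff.2 ?_
  have : partialDeriv φ i ∘ toTorus
      = fun x => fderiv ℝ (fun x : Fin n → ℝ => φ (toTorus x)) x (Pi.single i 1) := by
    funext x
    exact partialDeriv_toTorus h i x
  rw [this]
  exact (ContDiff.continuous_fderiv h (by simp)).clm_apply continuous_const

theorem IsTestFunction.continuous_projGrad {d n : ℕ} (P : Matrix (Fin d) (Fin n) ℝ)
    {φ : Torus n → ℂ} (h : IsTestFunction φ) (j : Fin d) :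
    Continuous (fun y => projGrad P φ y j) := by
  unfold projGrad
  exact continuous_finsetSum _ fun i _ => continuous_const.mul (h.continuous_partialDeriv i)

theorem integrable_mul_of_continuous {n : ℕ} (U : L2 n) {g : Torus n → ℂ} (hg : Continuous g) :
    Integrable (fun y => U y * g y) (torusMeasure n) := by
  have hU : MemLp U 2 (torusMeasure n) := Lp.memLp U
  have hg2 : MemLp g 2 (torusMeasure n) := hg.memLp_of_hasCompactSupport
    (HasCompactSupport.of_compactSpace g)
  exact hU.integrable_mul hg2

theorem integral_add_smul_mul {n : ℕ} (c : ℂ) (U U' : L2 n) {g : Torus n → ℂ}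
    (hg : Continuous g) :
    ∫ y, (c • U + U' : L2 n) y * g y ∂(torusMeasure n)
      = c * ∫ y, U y * g y ∂(torusMeasure n) + ∫ y, U' y * g y ∂(torusMeasure n) := by
  rw [← integral_const_mul, ← integral_add ((integrable_mul_of_continuous U hg).const_mul c)
    (integrable_mul_of_continuous U' hg)]
  refine integral_congr_ae ?_
  filter_upwards [Lp.coeFn_add (c • U) U', Lp.coeFn_smul c U] with y h1 h2
  rw [h1, Pi.add_apply, h2, Pi.smul_apply, smul_eq_mul]
  ring

theorem IsWeakProjGrad.add_smul {d n : ℕ} {P : Matrix (Fin d) (Fin n) ℝ} {U U' : L2 n}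
    {W W' : Fin d → L2 n} (c : ℂ) (h : IsWeakProjGrad P U W) (h' : IsWeakProjGrad P U' W') :
    IsWeakProjGrad P (c • U + U') (fun j => c • W j + W' j) := by
  intro φ hφ j
  rw [integral_add_smul_mul c _ _ hφ.continuous,
    integral_add_smul_mul c _ _ (hφ.continuous_projGrad P j), h φ hφ j, h' φ hφ j]
  ring

theorem IsWeakProjGrad.zero {d n : ℕ} (P : Matrix (Fin d) (Fin n) ℝ) :
    IsWeakProjGrad P (0 : L2 n) (fun _ : Fin d => (0 : L2 n)) := by
  intro φ hφ j
  have h0 : ∀ g : Torus n → ℂ, ∫ y, (0 : L2 n) y * g y ∂(torusMeasure n) = 0 := by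
    intro g
    refine integral_eq_zero_of_ae ?_
    filter_upwards [Lp.coeFn_zero ℂ 2 (torusMeasure n)] with y hy
    rw [hy]
    simp
  rw [h0, h0, neg_zero]

/-! ### The space `H¹_P(𝕋ⁿ)` and the solution operator -/

/-- The space `H¹_P(𝕋ⁿ) = {U ∈ L² : P∇U ∈ (L²)ᵈ}`. An element `U` is stored together with its
weak `P∇U`, i.e. as the pair `(U, P∇U)`, so that the inner product inherited from
`L² × (L²)ᵈ` is `(U, V) + (P∇U, P∇V)`. -/
def H1P {d n : ℕ} (P : Matrix (Fin d) (Fin n) ℝ) :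
    Submodule ℂ (WithLp 2 (L2 n × PiLp 2 (fun _ : Fin d => L2 n))) where
  carrier := {p | IsWeakProjGrad P p.fst (fun j => p.snd j)}
  zero_mem' := IsWeakProjGrad.zero P
  add_mem' := by
    intro p q hp hq
    have h := IsWeakProjGrad.add_smul 1 hp hq
    simp only [one_smul] at h
    exact h
  smul_mem' := by
    intro c p hp
    have h := IsWeakProjGrad.add_smul c hp (IsWeakProjGrad.zero P)
    simp only [add_zero] at h
    exact h

/-- The underlying function `U ∈ L²(𝕋ⁿ)` of an element of `H¹_P(𝕋ⁿ)`. -/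
def toL2 {d n : ℕ} {P : Matrix (Fin d) (Fin n) ℝ} (U : H1P P) : L2 n :=
  (U : WithLp 2 (L2 n × PiLp 2 (fun _ : Fin d => L2 n))).fst

/-- The weak `P∇U` of an element `U` of `H¹_P(𝕋ⁿ)`. -/
def weakGrad {d n : ℕ} {P : Matrix (Fin d) (Fin n) ℝ} (U : H1P P) (j : Fin d) : L2 n :=
  (U : WithLp 2 (L2 n × PiLp 2 (fun _ : Fin d => L2 n))).snd j

/-- `(F, G) = |𝕋ⁿ|⁻¹ ∫ F \bar G dy`. -/
def innerL2 {n : ℕ} (F G : Torus n → ℂ) : ℂ :=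
  ∫ y, F y * conj (G y) ∂(torusMeasure n)

/-- The sesquilinear form `a(U, V) = (𝒜 P∇U, P∇V) + (U, V)` on `H¹_P(𝕋ⁿ)`. -/
def formA {d n : ℕ} (P : Matrix (Fin d) (Fin n) ℝ) (𝒜 : Torus n → Matrix (Fin d) (Fin d) ℝ)
    (U V : H1P P) : ℂ :=
  (∑ j, innerL2 (fun y => ∑ l, (𝒜 y j l : ℂ) * weakGrad U l y) (fun y => weakGrad V j y))
    + innerL2 (fun y => toL2 U y) (fun y => toL2 V y)

/-- `K` is the solution operator: `a(K F, V) = (F, V)` for all `F, V ∈ H¹_P(𝕋ⁿ)`. -/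
def IsSolutionOperator {d n : ℕ} (P : Matrix (Fin d) (Fin n) ℝ)
    (𝒜 : Torus n → Matrix (Fin d) (Fin d) ℝ) (K : H1P P →L[ℂ] H1P P) : Prop :=
  ∀ F V : H1P P, formA P 𝒜 (K F) V = innerL2 (fun y => toL2 F y) (fun y => toL2 V y)

/-! ### The projection method -/

/-- The character `y ↦ exp(i kᵀ y)` of the torus. -/
def character {n : ℕ} (k : Fin n → ℤ) : C(Torus n, ℂ) where
  toFun y := ∏ i, fourier (k i) (y i)
  continuous_toFun := by fun_prop

/-- The frequencies `k ∈ ℤⁿ` with `-N/2 ≤ k_j < N/2` for all `j`. -/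
def freqSet (n N : ℕ) : Set (Fin n → ℤ) :=
  {k | ∀ j, -(N : ℝ) / 2 ≤ (k j : ℝ) ∧ (k j : ℝ) < (N : ℝ) / 2}

/-- The space `V^N` of trigonometric polynomials with frequencies in `freqSet n N`. -/
def trigSpace (n N : ℕ) : Submodule ℂ C(Torus n, ℂ) :=
  Submodule.span ℂ (character '' freqSet n N)

/-- The grid point `(2π j₁/N, …, 2π jₙ/N)`. -/
def gridPoint {n N : ℕ} (j : Fin n → Fin N) : Torus n :=
  toTorus fun i => 2 * π * ((j i : ℕ) : ℝ) / (N : ℝ)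

/-- The discrete inner product `(F, G)_N = N⁻ⁿ ∑_j F(y_j) \bar G(y_j)`. -/
def innerGrid {n : ℕ} (N : ℕ) (F G : Torus n → ℂ) : ℂ :=
  (1 / (N : ℂ) ^ n) * ∑ j : Fin n → Fin N, F (gridPoint j) * conj (G (gridPoint j))

/-- The discrete form `a_p(U, V) = (𝒜 P∇U, P∇V)_N + (U, V)_N`. -/
def formGrid {d n : ℕ} (P : Matrix (Fin d) (Fin n) ℝ)
    (𝒜 : Torus n → Matrix (Fin d) (Fin d) ℝ) (N : ℕ) (U V : Torus n → ℂ) : ℂ :=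
  (∑ j, innerGrid N (fun y => ∑ l, (𝒜 y j l : ℂ) * projGrad P U y l)
      (fun y => projGrad P V y j))
    + innerGrid N U V

/-- `K_N` is the discrete solution operator: `a_p(K_N F, G) = (F, G)_N` for all `F, G ∈ V^N`. -/
def IsDiscreteSolutionOperator {d n : ℕ} (P : Matrix (Fin d) (Fin n) ℝ)
    (𝒜 : Torus n → Matrix (Fin d) (Fin d) ℝ) (N : ℕ)
    (KN : Module.End ℂ (trigSpace n N)) : Prop :=
  ∀ F G : trigSpace n N, formGrid P 𝒜 N ⇑(KN F : C(Torus n, ℂ)) ⇑(G : C(Torus n, ℂ))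
    = innerGrid N ⇑(F : C(Torus n, ℂ)) ⇑(G : C(Torus n, ℂ))

end QEO

end

noncomputable section

namespace QEO

/-! Write $A$ for the operator on $V$ that represents $a$ and $B$ for the one that represents
$(\cdot,\cdot)$, so that $K=A^{-1}B$. The orbit $\{P^Tx\}$ is dense in the torus, because rational
independence of the columns leaves no nontrivial character equal to one along it. Symmetry and
ellipticity therefore pass from $\alpha$ to $\mathcal A$, $A$ is symmetric and coercive, and
Lax–Milgram gives $K$. No compactness is used. Since $K$ is symmetric for $a$, every
$\gamma\in\sigma(K)$ has approximate eigenvectors, and trigonometric polynomials are dense in $V$,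
so some trigonometric polynomial $\varphi$ satisfies
$\|K\varphi-\gamma\varphi\|<\varepsilon\|\varphi\|$ (`exists_trigPoly_approx_eigenvector`).

On the discrete side, the grid sum is exact for $F\overline G$ with $F,G\in V^N$
(`innerGrid_eq_innerL2`), since two frequencies of the box cannot alias. Hence $a_p$ is equivalent
to the squared norm of $V$ on $V^N$, with constants free of $N$ (`formGrid_bounds`). A Strang-type
estimate then gives $K_N\varphi\to K\varphi$ in $V$ for each fixed trigonometric polynomial
(`eventually_norm_discreteSolution_sub_le`), so $\varphi$ is also an approximate eigenvector of
$K_N$ for large $N$. As $K_N$ is symmetric for $a_p$ on a finite-dimensional space, a small residual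
forces an eigenvalue near $\gamma$ (`IsHermitianForm.exists_mem_spectrum_near`). -/

/-! ### Characters of the torus and their density in the continuous functions -/

theorem character_apply {n : ℕ} (k : Fin n → ℤ) (y : Torus n) :
    character k y = ∏ i, fourier (k i) (y i) := rfl

theorem character_zero {n : ℕ} : character (0 : Fin n → ℤ) = 1 := by
  ext y
  simp [character_apply]

theorem character_add {n : ℕ} (k l : Fin n → ℤ) :
    character (k + l) = character k * character l := by
  ext y
  simp [character_apply, Finset.prod_mul_distrib]

theorem character_neg_apply {n : ℕ} (k : Fin n → ℤ) (y : Torus n) :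
    character (-k) y = conj (character k y) := by
  simp [character_apply]

theorem character_apply_add {n : ℕ} (k : Fin n → ℤ) (y z : Torus n) :
    character k (y + z) = character k y * character k z := by
  simp [character_apply, Finset.prod_mul_distrib, AddCircle.toCircle_add]

theorem character_toTorus {n : ℕ} (k : Fin n → ℤ) (x : Fin n → ℝ) :
    character k (toTorus x) = Complex.exp (Complex.I * ((∑ i, (k i : ℝ) * x i : ℝ) : ℂ)) := by
  have hπ : (π : ℂ) ≠ 0 := by exact_mod_cast Real.pi_ne_zero
  simp only [character_apply, toTorus, fourier_coe_apply]
  rw [← Complex.exp_sum]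
  congr 1
  push_cast
  rw [Finset.mul_sum]
  refine Finset.sum_congr rfl fun i _ => ?_
  field_simp

theorem norm_character_apply {n : ℕ} (k : Fin n → ℤ) (y : Torus n) : ‖character k y‖ = 1 := by
  rw [character_apply, norm_prod]
  exact Finset.prod_eq_one fun i _ => by rw [fourier_apply]; exact Circle.norm_coe _

/-- The linear span of all characters is dense in the continuous functions. -/
theorem span_character_closure_eq_top (n : ℕ) :
    (Submodule.span ℂ (Set.range (character (n := n)))).topologicalClosure = ⊤ := by
  let S : StarSubalgebra ℂ C(Torus n, ℂ) :=
    { toSubalgebra := Algebra.adjoin ℂ (Set.range (character (n := n)))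
      star_mem' := by
        change Algebra.adjoin ℂ (Set.range (character (n := n)))
          ≤ star (Algebra.adjoin ℂ (Set.range (character (n := n))))
        refine Algebra.adjoin_le ?_
        rintro _ ⟨k, rfl⟩
        refine Algebra.subset_adjoin ⟨-k, ?_⟩
        ext1 y
        simp only [character_neg_apply, starRingEnd_apply, ContinuousMap.star_apply] }
  -- Characters are closed under products, so the algebra they generate is already their linear
  -- span.
  have hcoe : S.toSubalgebra.toSubmodule = Submodule.span ℂ (Set.range (character (n := n))) := by
    apply Algebra.adjoin_eq_span_of_subset
    refine .trans (fun x ↦ Submonoid.closure_induction (fun _ ↦ id) ⟨0, character_zero⟩ ?_)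
      Submodule.subset_span
    rintro _ _ _ _ ⟨k, rfl⟩ ⟨l, rfl⟩
    exact ⟨k + l, character_add k l⟩
  have hsep : S.SeparatesPoints := by
    intro x y hxy
    obtain ⟨i, hi⟩ := Function.ne_iff.1 hxy
    refine ⟨_, ⟨character (Pi.single i 1), Algebra.subset_adjoin ⟨Pi.single i 1, rfl⟩, rfl⟩, ?_⟩
    have key : ∀ z : Torus n, character (Pi.single i 1) z = fourier 1 (z i) := by
      intro z
      rw [character_apply, Finset.prod_eq_single i]
      · simp
      · intro j _ hj
        simp [Pi.single_eq_of_ne hj]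
      · simp
    dsimp only
    rw [key, key, fourier_one, fourier_one]
    exact fun h => hi (AddCircle.injective_toCircle (ne_of_gt Real.two_pi_pos)
      (Circle.coe_injective h))
  rw [← hcoe]
  exact congr_arg (Subalgebra.toSubmodule <| StarSubalgebra.toSubalgebra ·)
    (ContinuousMap.starSubalgebra_topologicalClosure_eq_top_of_separatesPoints S hsep)

/-- The integral factors over the coordinates. In a coordinate with $k_i\ne0$, translation by half a
period of the factor flips its sign, so that integral vanishes. -/
theorem integral_character {n : ℕ} (k : Fin n → ℤ) :
    ∫ y, character k y ∂(torusMeasure n) = if k = 0 then 1 else 0 := by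
  split_ifs with h
  · subst h
    simp [character_zero]
  · obtain ⟨i, hi⟩ := Function.ne_iff.1 h
    simp only [character_apply]
    rw [integral_fintype_prod_eq_prod (𝕜 := ℂ)]
    refine Finset.prod_eq_zero (Finset.mem_univ i) ?_
    exact integral_eq_zero_of_add_right_eq_neg
      (μ := AddCircle.haarAddCircle (T := 2 * π)) (fourier_add_half_inv_index hi Real.two_pi_pos)

/-- Two finite measures that agree on characters agree on all continuous functions. -/
theorem integral_eq_of_integral_character_eq {n : ℕ} {μ ν : Measure (Torus n)}
    [IsFiniteMeasure μ] [IsFiniteMeasure ν]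
    (h : ∀ k, ∫ y, character k y ∂μ = ∫ y, character k y ∂ν) (f : C(Torus n, ℂ)) :
    ∫ y, f y ∂μ = ∫ y, f y ∂ν := by
  have hcont : ∀ (ρ : Measure (Torus n)) [IsFiniteMeasure ρ],
      Continuous fun f : C(Torus n, ℂ) => ∫ y, f y ∂ρ := fun ρ _ =>
    continuous_iff_continuousAt.2 fun f =>
      MeasureTheory.tendsto_integral_filter_of_norm_le_const
        (Eventually.of_forall fun g => g.continuous.aestronglyMeasurable)
        ⟨‖f‖ + 1, by
          filter_upwards [Metric.ball_mem_nhds f one_pos] with g hg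
          refine ae_of_all _ fun y => (g.norm_coe_le_norm y).trans ?_
          rw [mem_ball_iff_norm] at hg
          linarith [norm_le_norm_add_norm_sub' g f]⟩
        (ae_of_all _ fun y =>
          (continuous_eval_const y : Continuous fun f : C(Torus n, ℂ) => f y).tendsto f)
  have hint : ∀ (ρ : Measure (Torus n)) [IsFiniteMeasure ρ] (f : C(Torus n, ℂ)),
      Integrable f ρ := fun ρ _ f =>
    f.continuous.integrable_of_hasCompactSupport (HasCompactSupport.of_compactSpace f)
  have hf : f ∈ (Submodule.span ℂ (Set.range (character (n := n)))).topologicalClosure := by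
    rw [span_character_closure_eq_top]; trivial
  have hf' : f ∈ closure (Submodule.span ℂ (Set.range (character (n := n))) : Set _) := hf
  refine closure_minimal (t := {f : C(Torus n, ℂ) | ∫ y, f y ∂μ = ∫ y, f y ∂ν}) ?_
    (isClosed_eq (hcont μ) (hcont ν)) hf'
  intro g hg
  induction hg using Submodule.span_induction with
  | mem x hx => obtain ⟨k, rfl⟩ := hx; exact h k
  | zero => simp
  | add x y _ _ hx hy =>
    simp only [Set.mem_ofPred_eq, ContinuousMap.add_apply] at *
    rw [integral_add (hint μ x) (hint μ y), integral_add (hint ν x) (hint ν y), hx, hy]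
  | smul c x _ hx =>
    simp only [Set.mem_ofPred_eq, ContinuousMap.smul_apply, integral_smul] at *
    rw [hx]

/-! ### Density of the orbit and extension of the bounds to the torus -/

/-- A relation $Pk=0$ with integer $k$ is a rational relation between the columns. The rational
independence of the columns enters the proof only here. -/
theorem IsProjectionMatrix.mulVec_ne_zero {d n : ℕ} {P : Matrix (Fin d) (Fin n) ℝ}
    (hP : IsProjectionMatrix P) {k : Fin n → ℤ} (hk : k ≠ 0) :
    P *ᵥ (fun i => (k i : ℝ)) ≠ 0 := by
  intro h0
  refine hk ?_
  have := Fintype.linearIndependent_iff.1 hP.1 (fun i => (k i : ℚ)) ?_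
  · funext i
    exact_mod_cast this i
  · funext j
    have := congrFun h0 j
    simp only [Matrix.mulVec, dotProduct, Pi.zero_apply] at this
    simp only [Finset.sum_apply, Pi.smul_apply, Pi.zero_apply, Rat.smul_def]
    rw [← this]
    exact Finset.sum_congr rfl fun i _ => by push_cast; ring

theorem IsProjectionMatrix.exists_character_ne_one {d n : ℕ} {P : Matrix (Fin d) (Fin n) ℝ}
    (hP : IsProjectionMatrix P) {k : Fin n → ℤ} (hk : k ≠ 0) :
    ∃ x : Fin d → ℝ, character k (toTorus (Pᵀ *ᵥ x)) ≠ 1 := by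
  set v := P *ᵥ (fun i => (k i : ℝ)) with hv
  have hpos : v ⬝ᵥ v ≠ 0 := fun h =>
    hP.mulVec_ne_zero hk (dotProduct_self_eq_zero.1 h)
  -- Scaled so that $k\cdot P^Tx = Pk\cdot x=\pi$, which makes the character equal to $-1$.
  refine ⟨(π / (v ⬝ᵥ v)) • v, ?_⟩
  have : ∑ i, (k i : ℝ) * (Pᵀ *ᵥ ((π / (v ⬝ᵥ v)) • v)) i = π := by
    change (fun i => (k i : ℝ)) ⬝ᵥ (Pᵀ *ᵥ ((π / (v ⬝ᵥ v)) • v)) = π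
    rw [dotProduct_mulVec, vecMul_transpose, ← hv, dotProduct_smul, smul_eq_mul]
    field_simp
  rw [character_toTorus, this, mul_comm, Complex.exp_pi_mul_I]
  norm_num

/-- The additive subgroup `{toTorus (Pᵀ x)}` of the torus. -/
def orbit {d n : ℕ} (P : Matrix (Fin d) (Fin n) ℝ) : AddSubgroup (Torus n) where
  carrier := Set.range fun x : Fin d → ℝ => (toTorus (Pᵀ *ᵥ x) : Torus n)
  zero_mem' := ⟨0, by funext i; simp [toTorus]⟩
  add_mem' := by
    rintro _ _ ⟨x, rfl⟩ ⟨z, rfl⟩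
    exact ⟨x + z, by simp only [Matrix.mulVec_add, toTorus_add]⟩
  neg_mem' := by
    rintro _ ⟨x, rfl⟩
    exact ⟨-x, by funext i; simp [toTorus, Matrix.mulVec_neg]⟩

/-- A closed subgroup of the torus that no nontrivial character annihilates is everything. -/
theorem mem_of_exists_character_ne_one {n : ℕ} (H : AddSubgroup (Torus n))
    (hclosed : IsClosed (H : Set (Torus n)))
    (h : ∀ k : Fin n → ℤ, k ≠ 0 → ∃ y ∈ H, character k y ≠ 1) (y : Torus n) : y ∈ H := by
  have : CompactSpace H := isCompact_iff_compactSpace.1 hclosed.isCompact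
  -- The Haar measure of `H`, pushed to the torus, kills each nontrivial character by translation
  -- inside `H`. It therefore integrates continuous functions like a multiple of the torus measure.
  set μ : Measure (Torus n) := (Measure.addHaar : Measure H).map Subtype.val with hμ
  have : IsFiniteMeasure μ := by rw [hμ]; infer_instance
  have hmap : ∀ f : Torus n → ℂ, Continuous f →
      ∫ y, f y ∂μ = ∫ y : H, f y ∂(Measure.addHaar : Measure H) := fun f hf =>
    integral_map measurable_subtype_coe.aemeasurable hf.aestronglyMeasurable
  have huniv : μ Set.univ ≠ 0 := by
    rw [hμ, Measure.map_apply measurable_subtype_coe MeasurableSet.univ, Set.preimage_univ]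
    exact (isOpen_univ.measure_pos _ Set.univ_nonempty).ne'
  have : IsFiniteMeasure (μ Set.univ • torusMeasure n) :=
    Measure.smul_finite _ (measure_ne_top μ _)
  have hchar : ∀ k : Fin n → ℤ,
      ∫ y, character k y ∂μ = ∫ y, character k y ∂(μ Set.univ • torusMeasure n) := by
    intro k
    rw [integral_smul_measure, integral_character]
    split_ifs with hk
    · subst hk
      simp [character_zero, Measure.real]
    · obtain ⟨z, hz, hz1⟩ := h k hk
      rw [smul_zero, hmap _ (character k).continuous]
      have h1 := integral_add_right_eq_self (μ := (Measure.addHaar : Measure H))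
        (fun y : H => character k (y : Torus n)) ⟨z, hz⟩
      simp only [AddSubgroup.coe_add, character_apply_add] at h1
      rw [integral_mul_const] at h1
      have h2 : (∫ y : H, character k (y : Torus n) ∂(Measure.addHaar : Measure H))
          * (character k z - 1) = 0 := by rw [mul_sub, h1]; ring
      exact (mul_eq_zero.1 h2).resolve_right (sub_ne_zero.2 hz1)
  by_contra hy
  have hne : (H : Set (Torus n)).Nonempty := ⟨0, H.zero_mem⟩
  have hcont : Continuous fun y : Torus n => Metric.infDist y (H : Set (Torus n)) :=
    Metric.continuous_infDist_pt _
  -- The distance to `H` separates the two measures: it vanishes on the support side `H`, but has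
  -- positive integral over the torus if some point lies outside the closed set `H`.
  have hkey := integral_eq_of_integral_character_eq hchar
    ⟨fun y => ((Metric.infDist y (H : Set (Torus n)) : ℝ) : ℂ),
      Complex.continuous_ofReal.comp hcont⟩
  simp only [ContinuousMap.coe_mk] at hkey
  rw [hmap (fun y => ((Metric.infDist y (H : Set (Torus n)) : ℝ) : ℂ))
    (Complex.continuous_ofReal.comp hcont), integral_smul_measure] at hkey
  have h0 : ∀ y : H, Metric.infDist (y : Torus n) (H : Set (Torus n)) = 0 := fun y =>
    Metric.infDist_zero_of_mem y.2
  simp only [h0, Complex.ofReal_zero, integral_zero, integral_complex_ofReal] at hkey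
  have hpos : 0 < ∫ y, Metric.infDist y (H : Set (Torus n)) ∂(torusMeasure n) := by
    refine hcont.integral_pos_of_hasCompactSupport_nonneg_nonzero
      (HasCompactSupport.of_compactSpace _) (fun _ => Metric.infDist_nonneg) (x := y) ?_
    exact ((hclosed.notMem_iff_infDist_pos hne).1 hy).ne'
  have h3 := smul_eq_zero.1 hkey.symm
  rcases h3 with h3 | h3
  · exact ENNReal.toReal_ne_zero.2 ⟨huniv, measure_ne_top μ _⟩ h3
  · exact hpos.ne' (by exact_mod_cast h3)

/-- The points `Pᵀ x` are dense in the torus. -/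
theorem IsProjectionMatrix.denseRange_toTorus {d n : ℕ} {P : Matrix (Fin d) (Fin n) ℝ}
    (hP : IsProjectionMatrix P) :
    DenseRange fun x : Fin d → ℝ => (toTorus (Pᵀ *ᵥ x) : Torus n) := by
  intro y
  refine mem_of_exists_character_ne_one (orbit P).topologicalClosure
    (AddSubgroup.isClosed_topologicalClosure _) (fun k hk => ?_) y
  obtain ⟨x, hx⟩ := hP.exists_character_ne_one hk
  exact ⟨_, AddSubgroup.le_topologicalClosure _ ⟨x, rfl⟩, hx⟩

/-- Symmetry and ellipticity extend from the orbit to the whole torus. -/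
theorem IsProjectionMatrix.parent_bounds {d n : ℕ} {P : Matrix (Fin d) (Fin n) ℝ}
    (hP : IsProjectionMatrix P) {𝒜 : Torus n → Matrix (Fin d) (Fin d) ℝ} (h𝒜 : Continuous 𝒜)
    {C₀ C₁ : ℝ} (hsymm : ∀ x : Fin d → ℝ, (𝒜 (toTorus (Pᵀ *ᵥ x))).IsSymm)
    (hell : ∀ x ξ : Fin d → ℝ, C₀ * (ξ ⬝ᵥ ξ) ≤ ξ ⬝ᵥ (𝒜 (toTorus (Pᵀ *ᵥ x)) *ᵥ ξ) ∧
      ξ ⬝ᵥ (𝒜 (toTorus (Pᵀ *ᵥ x)) *ᵥ ξ) ≤ C₁ * (ξ ⬝ᵥ ξ)) (y : Torus n) :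
    (𝒜 y).IsSymm ∧ ∀ ξ : Fin d → ℝ, C₀ * (ξ ⬝ᵥ ξ) ≤ ξ ⬝ᵥ (𝒜 y *ᵥ ξ) ∧
      ξ ⬝ᵥ (𝒜 y *ᵥ ξ) ≤ C₁ * (ξ ⬝ᵥ ξ) := by
  have hq : ∀ ξ : Fin d → ℝ, Continuous fun y => ξ ⬝ᵥ (𝒜 y *ᵥ ξ) := fun ξ =>
    continuous_const.dotProduct (h𝒜.matrix_mulVec continuous_const)
  refine ⟨?_, fun ξ => ⟨?_, ?_⟩⟩
  · exact hP.denseRange_toTorus.induction_on (p := fun y => (𝒜 y).IsSymm) y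
      (isClosed_eq h𝒜.matrix_transpose h𝒜) hsymm
  · exact hP.denseRange_toTorus.induction_on (p := fun y => C₀ * (ξ ⬝ᵥ ξ) ≤ ξ ⬝ᵥ (𝒜 y *ᵥ ξ)) y
      (isClosed_le continuous_const (hq ξ)) fun x => (hell x ξ).1
  · exact hP.denseRange_toTorus.induction_on (p := fun y => ξ ⬝ᵥ (𝒜 y *ᵥ ξ) ≤ C₁ * (ξ ⬝ᵥ ξ)) y
      (isClosed_le (hq ξ) continuous_const) fun x => (hell x ξ).2

/-! ### Completeness of the characters in $L^2$ -/

theorem toLp_character_inner {n : ℕ} (k : Fin n → ℤ) (U : L2 n) :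
    inner ℂ (ContinuousMap.toLp (E := ℂ) 2 (torusMeasure n) ℂ (character k)) U
      = ∫ y, U y * character (-k) y ∂(torusMeasure n) := by
  rw [L2.inner_def]
  refine integral_congr_ae ?_
  filter_upwards [ContinuousMap.coeFn_toLp (p := 2) (𝕜 := ℂ) (torusMeasure n) (character k)]
    with y hy
  rw [hy, character_neg_apply, RCLike.inner_apply]

/-- An `L²` function all of whose Fourier coefficients vanish is zero. -/
theorem eq_zero_of_fourierCoeff_eq_zero {n : ℕ} {U : L2 n}
    (h : ∀ k : Fin n → ℤ, ∫ y, U y * character k y ∂(torusMeasure n) = 0) : U = 0 := by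
  have hd : (Submodule.span ℂ (Set.range fun k : Fin n → ℤ =>
      ContinuousMap.toLp (E := ℂ) 2 (torusMeasure n) ℂ (character k))).topologicalClosure = ⊤ := by
    simpa only [Submodule.map_span, ContinuousLinearMap.coe_coe, ← Set.range_comp,
      Function.comp_def] using
      (ContinuousMap.toLp_denseRange ℂ (torusMeasure n) ℂ
        (p := 2) (by simp)).topologicalClosure_map_submodule (span_character_closure_eq_top n)
  have hbot := (Submodule.topologicalClosure_eq_top_iff).1 hd
  rw [Submodule.eq_bot_iff] at hbot
  refine hbot U ?_
  rw [Submodule.mem_orthogonal]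
  intro V hV
  induction hV using Submodule.span_induction with
  | mem x hx =>
    obtain ⟨k, rfl⟩ := hx
    rw [toLp_character_inner, h]
  | zero => simp
  | add x y _ _ hx hy => rw [inner_add_left, hx, hy, add_zero]
  | smul c x _ hx => rw [inner_smul_left, hx, mul_zero]

/-! ### Test functions -/

theorem exists_toTorus_eq {n : ℕ} (y : Torus n) : ∃ x : Fin n → ℝ, toTorus x = y :=
  (isOpenQuotientMap_toTorus n).surjective y

/-- `partialDeriv` is a derivative at zero only. Moving the base point along the coordinate line
gives it at every `t`, as differentiation under the integral sign requires. -/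
theorem IsTestFunction.hasDerivAt {n : ℕ} {φ : Torus n → ℂ} (h : IsTestFunction φ) (i : Fin n)
    (y : Torus n) (t : ℝ) :
    HasDerivAt (fun t : ℝ => φ (y + toTorus (Pi.single i t)))
      (partialDeriv φ i (y + toTorus (Pi.single i t))) t := by
  obtain ⟨x, rfl⟩ := exists_toTorus_eq y
  have hd : Differentiable ℝ fun t : ℝ => φ (toTorus x + toTorus (Pi.single i t)) := by
    have h1 : Differentiable ℝ fun x : Fin n → ℝ => φ (toTorus x) :=
      ContDiff.differentiable h (by simp)
    have h2 : Differentiable ℝ fun t : ℝ => x + (Pi.single i t : Fin n → ℝ) :=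
      (differentiable_const x).add
        (ContinuousLinearMap.single ℝ (fun _ : Fin n => ℝ) i).differentiable
    simpa only [Function.comp_def, toTorus_add] using h1.comp h2
  suffices hder : partialDeriv φ i (toTorus x + toTorus (Pi.single i t))
      = deriv (fun t : ℝ => φ (toTorus x + toTorus (Pi.single i t))) t by
    rw [hder]
    exact (hd t).hasDerivAt
  unfold partialDeriv
  have hs : (fun s : ℝ => φ (toTorus x + toTorus (Pi.single i t) + toTorus (Pi.single i s)))
      = fun s : ℝ => (fun t : ℝ => φ (toTorus x + toTorus (Pi.single i t))) (t + s) := by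
    funext s
    simp only [Pi.single_add, toTorus_add, add_assoc]
  rw [hs, deriv_comp_const_add (f := fun t : ℝ => φ (toTorus x + toTorus (Pi.single i t))),
    add_zero]

theorem toTorus_single_zero {n : ℕ} (i : Fin n) :
    toTorus (Pi.single i (0 : ℝ)) = (0 : Torus n) := by
  funext j
  simp [toTorus]

theorem IsTestFunction.hasDerivAt_zero {n : ℕ} {φ : Torus n → ℂ} (h : IsTestFunction φ)
    (i : Fin n) (y : Torus n) :
    HasDerivAt (fun t : ℝ => φ (y + toTorus (Pi.single i t))) (partialDeriv φ i y) 0 := by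
  simpa only [toTorus_single_zero, add_zero] using h.hasDerivAt i y 0

theorem IsTestFunction.add {n : ℕ} {φ ψ : Torus n → ℂ} (hφ : IsTestFunction φ)
    (hψ : IsTestFunction ψ) : IsTestFunction (φ + ψ) :=
  ContDiff.add hφ hψ

theorem IsTestFunction.mul {n : ℕ} {φ ψ : Torus n → ℂ} (hφ : IsTestFunction φ)
    (hψ : IsTestFunction ψ) : IsTestFunction (φ * ψ) :=
  ContDiff.mul hφ hψ

theorem IsTestFunction.smul {n : ℕ} {φ : Torus n → ℂ} (c : ℂ) (hφ : IsTestFunction φ) :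
    IsTestFunction (c • φ) :=
  ContDiff.const_smul c hφ

theorem partialDeriv_add {n : ℕ} {φ ψ : Torus n → ℂ} (hφ : IsTestFunction φ)
    (hψ : IsTestFunction ψ) (i : Fin n) (y : Torus n) :
    partialDeriv (φ + ψ) i y = partialDeriv φ i y + partialDeriv ψ i y :=
  ((hφ.hasDerivAt_zero i y).add (hψ.hasDerivAt_zero i y)).deriv

theorem partialDeriv_smul {n : ℕ} {φ : Torus n → ℂ} (c : ℂ) (hφ : IsTestFunction φ) (i : Fin n)
    (y : Torus n) : partialDeriv (c • φ) i y = c * partialDeriv φ i y :=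
  ((hφ.hasDerivAt_zero i y).const_smul c).deriv

theorem partialDeriv_mul {n : ℕ} {φ ψ : Torus n → ℂ} (hφ : IsTestFunction φ)
    (hψ : IsTestFunction ψ) (i : Fin n) (y : Torus n) :
    partialDeriv (φ * ψ) i y = partialDeriv φ i y * ψ y + φ y * partialDeriv ψ i y := by
  have := ((hφ.hasDerivAt_zero i y).mul (hψ.hasDerivAt_zero i y)).deriv
  rw [toTorus_single_zero, add_zero] at this
  exact this

/-- The integral of a partial derivative over the torus vanishes. -/
theorem IsTestFunction.integral_partialDeriv {n : ℕ} {φ : Torus n → ℂ} (h : IsTestFunction φ)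
    (i : Fin n) : ∫ y, partialDeriv φ i y ∂(torusMeasure n) = 0 := by
  obtain ⟨C, hC⟩ : ∃ C, ∀ y, ‖partialDeriv φ i y‖ ≤ C := by
    obtain ⟨C, hC⟩ := isCompact_univ.exists_bound_of_continuousOn
      (h.continuous_partialDeriv i).continuousOn
    exact ⟨C, fun y => hC y trivial⟩
  have hshift : ∀ t : ℝ, Continuous fun y : Torus n => y + toTorus (Pi.single i t) := fun t =>
    continuous_id.add continuous_const
  have hint : ∀ g : Torus n → ℂ, Continuous g → Integrable g (torusMeasure n) := fun g hg =>
    hg.integrable_of_hasCompactSupport (HasCompactSupport.of_compactSpace g)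
  have key := (hasDerivAt_integral_of_dominated_loc_of_deriv_le (μ := torusMeasure n)
    (F := fun t y => φ (y + toTorus (Pi.single i t)))
    (F' := fun t y => partialDeriv φ i (y + toTorus (Pi.single i t))) (x₀ := (0 : ℝ))
    (bound := fun _ => C) (s := Set.univ) Filter.univ_mem
    (Eventually.of_forall fun t => (h.continuous.comp (hshift t)).aestronglyMeasurable)
    (hint _ (h.continuous.comp (hshift 0)))
    ((h.continuous_partialDeriv i).comp (hshift 0)).aestronglyMeasurable
    (ae_of_all _ fun y t _ => hC _) (integrable_const C)
    (ae_of_all _ fun y t _ => h.hasDerivAt i y t)).2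
  -- Translation invariance makes the integral constant in `t`, so its derivative is zero.
  have hconst : (fun t : ℝ => ∫ y, φ (y + toTorus (Pi.single i t)) ∂(torusMeasure n))
      = fun _ => ∫ y, φ y ∂(torusMeasure n) := by
    funext t
    exact integral_add_right_eq_self (μ := torusMeasure n) φ _
  rw [hconst] at key
  have := key.unique (hasDerivAt_const 0 _)
  simpa only [toTorus_single_zero, add_zero] using this

theorem projGrad_add {d n : ℕ} (P : Matrix (Fin d) (Fin n) ℝ) {φ ψ : Torus n → ℂ}
    (hφ : IsTestFunction φ) (hψ : IsTestFunction ψ) (y : Torus n) :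
    projGrad P (φ + ψ) y = projGrad P φ y + projGrad P ψ y := by
  funext j
  simp only [projGrad, partialDeriv_add hφ hψ, mul_add, Finset.sum_add_distrib, Pi.add_apply]

theorem projGrad_smul {d n : ℕ} (P : Matrix (Fin d) (Fin n) ℝ) {φ : Torus n → ℂ} (c : ℂ)
    (hφ : IsTestFunction φ) (y : Torus n) :
    projGrad P (c • φ) y = c • projGrad P φ y := by
  funext j
  simp only [projGrad, partialDeriv_smul c hφ, Pi.smul_apply, smul_eq_mul, Finset.mul_sum]
  exact Finset.sum_congr rfl fun i _ => by ring

/-- The product rule turns the sum of both sides into integrals of partial derivatives, which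
vanish. This is what makes the classical $P\nabla\varphi$ a weak one, so that `embed` lands in
$H^1_P$. -/
theorem integral_projGrad_mul {d n : ℕ} (P : Matrix (Fin d) (Fin n) ℝ) {φ ψ : Torus n → ℂ}
    (hφ : IsTestFunction φ) (hψ : IsTestFunction ψ) (j : Fin d) :
    ∫ y, projGrad P φ y j * ψ y ∂(torusMeasure n)
      = - ∫ y, φ y * projGrad P ψ y j ∂(torusMeasure n) := by
  have hint : ∀ g : Torus n → ℂ, Continuous g → Integrable g (torusMeasure n) := fun g hg =>
    hg.integrable_of_hasCompactSupport (HasCompactSupport.of_compactSpace g)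
  rw [← add_eq_zero_iff_eq_neg, ← integral_add
    (hint (fun y => projGrad P φ y j * ψ y) ((hφ.continuous_projGrad P j).mul hψ.continuous))
    (hint (fun y => φ y * projGrad P ψ y j) (hφ.continuous.mul (hψ.continuous_projGrad P j)))]
  have : ∀ y, projGrad P φ y j * ψ y + φ y * projGrad P ψ y j
      = ∑ i, (P j i : ℂ) * partialDeriv (φ * ψ) i y := by
    intro y
    simp only [projGrad, Finset.sum_mul, Finset.mul_sum, ← Finset.sum_add_distrib,
      partialDeriv_mul hφ hψ]
    exact Finset.sum_congr rfl fun i _ => by ring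
  simp only [this]
  rw [integral_finsetSum _ fun i _ =>
    ((hint _ ((hφ.mul hψ).continuous_partialDeriv i)).const_mul _)]
  refine Finset.sum_eq_zero fun i _ => ?_
  rw [integral_const_mul, (hφ.mul hψ).integral_partialDeriv, mul_zero]

theorem character_add_single {n : ℕ} (k : Fin n → ℤ) (y : Torus n) (i : Fin n) (t : ℝ) :
    character k (y + toTorus (Pi.single i t))
      = character k y * Complex.exp (Complex.I * ((k i : ℂ) * t)) := by
  rw [character_apply_add, character_toTorus]
  congr 3
  rw [Finset.sum_eq_single i (fun j _ hj => by simp [Pi.single_eq_of_ne hj]) (by simp)]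
  simp

theorem isTestFunction_character {n : ℕ} (k : Fin n → ℤ) : IsTestFunction (character k) := by
  unfold IsTestFunction
  simp only [character_toTorus]
  have h : ContDiff ℝ ∞ fun x : Fin n → ℝ => ∑ i, (k i : ℝ) * x i :=
    ContDiff.sum fun i _ => contDiff_const.mul (contDiff_apply ℝ ℝ i)
  exact Complex.contDiff_exp.comp (contDiff_const.mul (Complex.ofRealCLM.contDiff.comp h))

theorem partialDeriv_character {n : ℕ} (k : Fin n → ℤ) (i : Fin n) (y : Torus n) :
    partialDeriv (character k) i y = Complex.I * (k i : ℂ) * character k y := by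
  unfold partialDeriv
  simp only [character_add_single]
  have h1 : HasDerivAt (fun t : ℝ => Complex.I * ((k i : ℂ) * (t : ℂ)))
      (Complex.I * ((k i : ℂ) * 1)) 0 :=
    ((Complex.ofRealCLM.hasDerivAt (x := (0 : ℝ))).const_mul (k i : ℂ)).const_mul Complex.I
  rw [(h1.cexp.const_mul (character k y)).deriv]
  simp only [Complex.ofReal_zero, mul_zero, Complex.exp_zero, one_mul, mul_one]
  ring

/-- The vector `i P k`. -/
def symbol {d n : ℕ} (P : Matrix (Fin d) (Fin n) ℝ) (k : Fin n → ℤ) (j : Fin d) : ℂ :=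
  Complex.I * ((∑ i, P j i * (k i : ℝ) : ℝ) : ℂ)

theorem projGrad_character {d n : ℕ} (P : Matrix (Fin d) (Fin n) ℝ) (k : Fin n → ℤ)
    (y : Torus n) (j : Fin d) :
    projGrad P (character k) y j = symbol P k j * character k y := by
  simp only [projGrad, partialDeriv_character, symbol]
  push_cast
  rw [Finset.mul_sum, Finset.sum_mul]
  exact Finset.sum_congr rfl fun i _ => by ring

/-! ### The embedding of the test functions into `H¹_P` -/

/-- The smooth functions on the torus. -/
def testSpace (n : ℕ) : Submodule ℂ C(Torus n, ℂ) where
  carrier := {f | IsTestFunction f}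
  zero_mem' := (contDiff_const : ContDiff ℝ ∞ fun _ : Fin n → ℝ => (0 : ℂ))
  add_mem' := fun hf hg => IsTestFunction.add hf hg
  smul_mem' := fun c _ hf => IsTestFunction.smul c hf

/-- The `j`-th component of the classical `P∇φ` as a continuous function. -/
def testGrad {d n : ℕ} (P : Matrix (Fin d) (Fin n) ℝ) (j : Fin d) :
    testSpace n →ₗ[ℂ] C(Torus n, ℂ) where
  toFun φ := ⟨fun y => projGrad P φ y j, IsTestFunction.continuous_projGrad P φ.2 j⟩
  map_add' φ ψ := by
    ext y
    exact congrFun (projGrad_add P φ.2 ψ.2 y) j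
  map_smul' c φ := by
    ext y
    exact congrFun (projGrad_smul P c φ.2 y) j

/-- A continuous function as an element of `L²`. -/
abbrev contToL2 (n : ℕ) : C(Torus n, ℂ) →L[ℂ] L2 n :=
  ContinuousMap.toLp (E := ℂ) 2 (torusMeasure n) ℂ

theorem coeFn_contToL2 {n : ℕ} (f : C(Torus n, ℂ)) : contToL2 n f =ᵐ[torusMeasure n] f :=
  ContinuousMap.coeFn_toLp (p := 2) (𝕜 := ℂ) (torusMeasure n) f

theorem integral_contToL2_mul {n : ℕ} (f : C(Torus n, ℂ)) (g : Torus n → ℂ) :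
    ∫ y, contToL2 n f y * g y ∂(torusMeasure n) = ∫ y, f y * g y ∂(torusMeasure n) := by
  refine integral_congr_ae ?_
  filter_upwards [coeFn_contToL2 f] with y hy
  rw [hy]

theorem inner_contToL2 {n : ℕ} (f g : C(Torus n, ℂ)) :
    inner ℂ (contToL2 n g) (contToL2 n f) = innerL2 f g := by
  rw [ContinuousMap.inner_toLp]
  rfl

/-- The embedding `φ ↦ (φ, P∇φ)` of the smooth functions into `H¹_P`. -/
def embed {d n : ℕ} (P : Matrix (Fin d) (Fin n) ℝ) : testSpace n →ₗ[ℂ] H1P P where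
  toFun φ := ⟨WithLp.toLp 2 (contToL2 n φ, WithLp.toLp 2 fun j => contToL2 n (testGrad P j φ)), by
    intro ψ hψ j
    change ∫ y, contToL2 n (testGrad P j φ) y * ψ y ∂(torusMeasure n)
      = - ∫ y, contToL2 n φ y * projGrad P ψ y j ∂(torusMeasure n)
    rw [integral_contToL2_mul, integral_contToL2_mul]
    exact integral_projGrad_mul P φ.2 hψ j⟩
  map_add' φ ψ := by
    ext1
    refine WithLp.ofLp_injective 2 (Prod.ext ?_ ?_)
    · exact map_add (contToL2 n) _ _
    · refine WithLp.ofLp_injective 2 (funext fun j => ?_)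
      exact ((contToL2 n).toLinearMap ∘ₗ testGrad P j).map_add φ ψ
  map_smul' c φ := by
    ext1
    refine WithLp.ofLp_injective 2 (Prod.ext ?_ ?_)
    · exact map_smul (contToL2 n) _ _
    · refine WithLp.ofLp_injective 2 (funext fun j => ?_)
      exact ((contToL2 n).toLinearMap ∘ₗ testGrad P j).map_smul c φ

theorem toL2_embed {d n : ℕ} (P : Matrix (Fin d) (Fin n) ℝ) (φ : testSpace n) :
    toL2 (embed P φ) = contToL2 n φ := rfl

theorem weakGrad_embed {d n : ℕ} (P : Matrix (Fin d) (Fin n) ℝ) (φ : testSpace n) (j : Fin d) :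
    weakGrad (embed P φ) j = contToL2 n (testGrad P j φ) := rfl

/-! ### `H¹_P` is a Hilbert space -/

theorem integral_mul_eq_inner {n : ℕ} (U : L2 n) (g : C(Torus n, ℂ)) :
    ∫ y, U y * g y ∂(torusMeasure n) = inner ℂ (contToL2 n (star g)) U := by
  rw [L2.inner_def]
  refine integral_congr_ae ?_
  filter_upwards [coeFn_contToL2 (star g)] with y hy
  rw [hy, RCLike.inner_apply, ContinuousMap.star_apply]
  simp

/-- Each test function and component imposes an equality of two continuous functions of the pair.
Completeness of $H^1_P$ follows, and with it adjoints and Lax–Milgram. -/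
theorem isClosed_H1P {d n : ℕ} (P : Matrix (Fin d) (Fin n) ℝ) :
    IsClosed (H1P P : Set (WithLp 2 (L2 n × PiLp 2 (fun _ : Fin d => L2 n)))) := by
  have : (H1P P : Set (WithLp 2 (L2 n × PiLp 2 (fun _ : Fin d => L2 n))))
      = ⋂ φ : testSpace n, ⋂ j : Fin d,
        {p | inner ℂ (contToL2 n (star (φ : C(Torus n, ℂ)))) (p.snd j)
          = - inner ℂ (contToL2 n (star (testGrad P j φ))) p.fst} := by
    ext p
    simp only [Set.mem_iInter, Set.mem_ofPred_eq, ← integral_mul_eq_inner]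
    constructor
    · intro h φ j
      exact h φ φ.2 j
    · intro h φ hφ j
      exact h ⟨⟨φ, hφ.continuous⟩, hφ⟩ j
  rw [this]
  refine isClosed_iInter fun φ => isClosed_iInter fun j => isClosed_eq ?_ ?_
  · exact continuous_const.inner (by fun_prop)
  · exact (continuous_const.inner (by fun_prop)).neg

instance instCompleteSpaceH1P {d n : ℕ} (P : Matrix (Fin d) (Fin n) ℝ) :
    CompleteSpace (H1P P) :=
  (isClosed_H1P P).completeSpace_coe

theorem inner_H1P {d n : ℕ} {P : Matrix (Fin d) (Fin n) ℝ} (U V : H1P P) :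
    inner ℂ U V = inner ℂ (toL2 U) (toL2 V) + ∑ j, inner ℂ (weakGrad U j) (weakGrad V j) := by
  rw [Submodule.coe_inner, WithLp.prod_inner_apply, PiLp.inner_apply]
  rfl

theorem norm_sq_H1P {d n : ℕ} {P : Matrix (Fin d) (Fin n) ℝ} (U : H1P P) :
    ‖U‖ ^ 2 = ‖toL2 U‖ ^ 2 + ∑ j, ‖weakGrad U j‖ ^ 2 := by
  have h := congrArg RCLike.re (inner_H1P U U)
  simp only [map_add, map_sum, inner_self_eq_norm_sq (𝕜 := ℂ) (toL2 U),
    fun j => inner_self_eq_norm_sq (𝕜 := ℂ) (weakGrad U j)] at h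
  exact (inner_self_eq_norm_sq (𝕜 := ℂ) U).symm.trans h

theorem norm_toL2_le {d n : ℕ} {P : Matrix (Fin d) (Fin n) ℝ} (U : H1P P) :
    ‖toL2 U‖ ≤ ‖U‖ := by
  refine le_of_sq_le_sq ?_ (norm_nonneg _)
  rw [norm_sq_H1P]
  exact le_add_of_nonneg_right (Finset.sum_nonneg fun j _ => sq_nonneg _)

theorem norm_weakGrad_le {d n : ℕ} {P : Matrix (Fin d) (Fin n) ℝ} (U : H1P P) (j : Fin d) :
    ‖weakGrad U j‖ ≤ ‖U‖ := by
  refine le_of_sq_le_sq ?_ (norm_nonneg _)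
  rw [norm_sq_H1P]
  have := Finset.single_le_sum (f := fun j => ‖weakGrad U j‖ ^ 2) (fun j _ => sq_nonneg _)
    (Finset.mem_univ j)
  have h0 := sq_nonneg ‖toL2 U‖
  linarith

/-- `U ↦ U` as a bounded operator `H¹_P → L²`. -/
def toL2L {d n : ℕ} (P : Matrix (Fin d) (Fin n) ℝ) : H1P P →L[ℂ] L2 n :=
  LinearMap.mkContinuous
    { toFun := toL2, map_add' := fun _ _ => rfl, map_smul' := fun _ _ => rfl } 1
    fun U => (norm_toL2_le U).trans_eq (one_mul _).symm

/-- `U ↦ (P∇U)_j` as a bounded operator `H¹_P → L²`. -/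
def gradL {d n : ℕ} (P : Matrix (Fin d) (Fin n) ℝ) (j : Fin d) : H1P P →L[ℂ] L2 n :=
  LinearMap.mkContinuous
    { toFun := fun U => weakGrad U j, map_add' := fun _ _ => rfl, map_smul' := fun _ _ => rfl } 1
    fun U => (norm_weakGrad_le U j).trans_eq (one_mul _).symm

theorem gradL_apply {d n : ℕ} (P : Matrix (Fin d) (Fin n) ℝ) (j : Fin d) (U : H1P P) :
    gradL P j U = weakGrad U j := rfl

/-! ### Trigonometric polynomials are dense in `H¹_P` -/

/-- A character as a smooth function. -/
def charTest {n : ℕ} (k : Fin n → ℤ) : testSpace n :=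
  ⟨character k, isTestFunction_character k⟩

theorem testGrad_charTest {d n : ℕ} (P : Matrix (Fin d) (Fin n) ℝ) (k : Fin n → ℤ) (j : Fin d) :
    testGrad P j (charTest k) = symbol P k j • character k := by
  ext y
  exact projGrad_character P k y j

/-- The smooth functions that are trigonometric polynomials. -/
def trigPoly (n : ℕ) : Submodule ℂ (testSpace n) := Submodule.span ℂ (Set.range charTest)

theorem integral_weakGrad_mul_character {d n : ℕ} {P : Matrix (Fin d) (Fin n) ℝ} (U : H1P P)
    (k : Fin n → ℤ) (j : Fin d) :
    ∫ y, weakGrad U j y * character k y ∂(torusMeasure n)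
      = - (symbol P k j * ∫ y, toL2 U y * character k y ∂(torusMeasure n)) := by
  refine (U.2 (character k) (isTestFunction_character k) j).trans ?_
  rw [← integral_const_mul]
  congr 1
  refine integral_congr_ae (ae_of_all _ fun y => ?_)
  simp only [projGrad_character]
  change toL2 U y * (symbol P k j * character k y) = symbol P k j * (toL2 U y * character k y)
  ring

/-- The weight is $1+|Pk|^2$, which never vanishes. An element orthogonal to all embedded characters
thus has no Fourier coefficients, which proves density of trigonometric polynomials. -/
theorem inner_embed_charTest {d n : ℕ} (P : Matrix (Fin d) (Fin n) ℝ) (U : H1P P)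
    (k : Fin n → ℤ) :
    inner ℂ (embed P (charTest k)) U
      = (1 + ∑ j, conj (symbol P k j) * symbol P k j)
        * ∫ y, toL2 U y * character (-k) y ∂(torusMeasure n) := by
  have hneg : ∀ j, symbol P (-k) j = - symbol P k j := by
    intro j
    simp [symbol]
  rw [inner_H1P, toL2_embed, add_mul, one_mul, Finset.sum_mul]
  congr 1
  · exact toLp_character_inner k (toL2 U)
  · refine Finset.sum_congr rfl fun j _ => ?_
    rw [weakGrad_embed, testGrad_charTest, map_smul, inner_smul_left, mul_assoc]
    congr 1
    refine (toLp_character_inner k (weakGrad U j)).trans ?_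
    rw [integral_weakGrad_mul_character, hneg]
    ring

theorem exists_near_of_orthogonal_eq_zero {E : Type*} [NormedAddCommGroup E]
    [InnerProductSpace ℂ E] [CompleteSpace E] (S : Submodule ℂ E) (h : ∀ x ∈ Sᗮ, x = 0) (x : E)
    {ε : ℝ} (hε : 0 < ε) : ∃ y ∈ S, ‖x - y‖ < ε := by
  have hd : Dense (S : Set E) := Submodule.dense_iff_topologicalClosure_eq_top.2
    (Submodule.topologicalClosure_eq_top_iff.2 ((Submodule.eq_bot_iff _).2 h))
  obtain ⟨y, hy, hyS⟩ := Metric.dense_iff.1 hd x ε hε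
  exact ⟨y, hyS, mem_ball_iff_norm'.1 hy⟩

/-- The trigonometric polynomials are dense in `H¹_P`. -/
theorem exists_trigPoly_near {d n : ℕ} (P : Matrix (Fin d) (Fin n) ℝ) (U : H1P P) {ε : ℝ}
    (hε : 0 < ε) : ∃ φ ∈ trigPoly n, ‖U - embed P φ‖ < ε := by
  suffices h : ∀ U ∈ Submodule.orthogonal (𝕜 := ℂ) (E := H1P P) ((trigPoly n).map (embed P)),
      U = 0 by
    obtain ⟨_, ⟨φ, hφ, rfl⟩, hlt⟩ := exists_near_of_orthogonal_eq_zero (E := H1P P) _ h U hε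
    exact ⟨φ, hφ, hlt⟩
  intro U hU
  have hcoef : ∀ k : Fin n → ℤ, ∫ y, toL2 U y * character k y ∂(torusMeasure n) = 0 := by
    intro k
    have h := (Submodule.mem_orthogonal (𝕜 := ℂ) (E := H1P P) _ _).1 hU (embed P (charTest (-k)))
      (Submodule.mem_map_of_mem (Submodule.subset_span ⟨-k, rfl⟩))
    rw [inner_embed_charTest, neg_neg] at h
    refine (mul_eq_zero.1 h).resolve_left fun h0 => ?_
    have := congrArg Complex.re h0
    simp only [← Complex.normSq_eq_conj_mul_self, Complex.add_re, Complex.re_sum,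
      Complex.ofReal_re, Complex.one_re, Complex.zero_re] at this
    have h1 : 0 ≤ ∑ j, Complex.normSq (symbol P (-k) j) :=
      Finset.sum_nonneg fun j _ => Complex.normSq_nonneg _
    linarith
  have h0 : toL2 U = 0 := eq_zero_of_fourierCoeff_eq_zero hcoef
  have h1 : ∀ j, weakGrad U j = 0 := fun j => eq_zero_of_fourierCoeff_eq_zero fun k => by
    rw [integral_weakGrad_mul_character, hcoef, mul_zero, neg_zero]
  have h2 : ‖U‖ ^ 2 = 0 := by
    rw [norm_sq_H1P, h0]
    simp only [h1, norm_zero]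
    norm_num
  exact norm_eq_zero.1 (eq_zero_of_pow_eq_zero h2)

/-! ### Hermitian forms on finite-dimensional spaces -/

section HermitianForm

variable {E : Type*} [AddCommGroup E] [Module ℂ E]

/-- Hermitian forms, linear in the first argument. -/
structure IsHermitianForm (a : E → E → ℂ) : Prop where
  add_left : ∀ x y z, a (x + y) z = a x z + a y z
  smul_left : ∀ (c : ℂ) x y, a (c • x) y = c * a x y
  symm : ∀ x y, conj (a x y) = a y x

theorem IsHermitianForm.add_right {a : E → E → ℂ} (ha : IsHermitianForm a) (x y z : E) :
    a x (y + z) = a x y + a x z := by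
  rw [← ha.symm, ha.add_left, map_add, ha.symm, ha.symm]

theorem IsHermitianForm.smul_right {a : E → E → ℂ} (ha : IsHermitianForm a) (c : ℂ) (x y : E) :
    a x (c • y) = conj c * a x y := by
  rw [← ha.symm, ha.smul_left, map_mul, ha.symm]

theorem IsHermitianForm.sub_left {a : E → E → ℂ} (ha : IsHermitianForm a) (x y z : E) :
    a (x - y) z = a x z - a y z := by
  have h := ha.smul_left (-1) y z
  rw [neg_one_smul, neg_one_mul] at h
  rw [sub_eq_add_neg, ha.add_left, h, sub_eq_add_neg]

/-- `x ↦ a x z` as a linear map. -/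
def IsHermitianForm.leftMap {a : E → E → ℂ} (ha : IsHermitianForm a) (z : E) : E →ₗ[ℂ] ℂ where
  toFun x := a x z
  map_add' x y := ha.add_left x y z
  map_smul' c x := ha.smul_left c x z

/-- The inner product space structure of a positive definite hermitian form. -/
@[reducible]
def IsHermitianForm.core {a : E → E → ℂ} (ha : IsHermitianForm a)
    (hpos : ∀ x, x ≠ 0 → 0 < (a x x).re) : InnerProductSpace.Core ℂ E where
  -- The arguments are swapped because `inner` is linear in its second slot and the forms here in
  -- their first.
  inner x y := a y x
  conj_inner_symm x y := ha.symm x y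
  re_inner_nonneg x := by
    by_cases hx : x = 0
    · have h0 : a x x = 0 := by
        have := ha.smul_left 0 x x
        rwa [zero_smul, zero_mul, ← hx] at this
      exact (congrArg Complex.re h0).ge
    · exact (hpos x hx).le
  add_left x y z := ha.add_right z x y
  smul_left x y c := ha.smul_right c y x
  definite x hx := by
    by_contra h
    exact (hpos x h).ne' (by simp [show a x x = 0 from hx])

/-- Riesz representation for the inner product `a`: in an `a`-orthonormal basis $e_i$, the vector
$Tx$ must have coordinates $b(x,e_i)$. No positivity of `b` is needed. -/
theorem IsHermitianForm.existsUnique_solution [FiniteDimensional ℂ E] {a b : E → E → ℂ}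
    (ha : IsHermitianForm a) (hpos : ∀ x, x ≠ 0 → 0 < (a x x).re) (hb : IsHermitianForm b) :
    ∃! T : Module.End ℂ E, ∀ x y, a (T x) y = b x y := by
  let : NormedAddCommGroup E := (ha.core hpos).toNormedAddCommGroup
  let : InnerProductSpace ℂ E := InnerProductSpace.ofCore (ha.core hpos).toCore
  have hinner : ∀ x y : E, inner ℂ x y = a y x := fun x y => rfl
  have hex : ∀ x y, a ((∑ i, (hb.leftMap (stdOrthonormalBasis ℂ E i)).smulRight
      (stdOrthonormalBasis ℂ E i) : Module.End ℂ E) x) y = b x y := by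
    intro x y
    have h1 : b x y = ∑ i, inner ℂ y (stdOrthonormalBasis ℂ E i)
        * b x (stdOrthonormalBasis ℂ E i) := by
      rw [← hb.symm y x]
      conv_lhs => rw [← (stdOrthonormalBasis ℂ E).sum_repr' y]
      change conj (hb.leftMap x _) = _
      rw [map_sum, map_sum]
      refine Finset.sum_congr rfl fun i _ => ?_
      rw [map_smul, smul_eq_mul, map_mul, inner_conj_symm]
      congr 1
      exact hb.symm _ _
    rw [h1, ← hinner, LinearMap.sum_apply, inner_sum]
    refine Finset.sum_congr rfl fun i _ => ?_
    rw [LinearMap.smulRight_apply, inner_smul_right, mul_comm]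
    rfl
  exact ⟨_, hex, fun T hT => LinearMap.ext fun x => ext_inner_left ℂ fun y =>
    (hT x y).trans (hex x y).symm⟩

/-- For an operator that is symmetric for a positive definite form, the distance of `γ` to the
spectrum is at most the relative size of the residual of any vector. -/
theorem IsHermitianForm.exists_mem_spectrum_near [FiniteDimensional ℂ E] {a : E → E → ℂ}
    (ha : IsHermitianForm a) (hpos : ∀ x, x ≠ 0 → 0 < (a x x).re) {T : Module.End ℂ E}
    (hT : ∀ x y, a (T x) y = a x (T y)) (γ : ℂ) {x : E} (hx : x ≠ 0) :
    ∃ μ ∈ spectrum ℂ T, ‖γ - μ‖ ^ 2 * (a x x).re ≤ (a (T x - γ • x) (T x - γ • x)).re := by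
  let : NormedAddCommGroup E := (ha.core hpos).toNormedAddCommGroup
  let : InnerProductSpace ℂ E := InnerProductSpace.ofCore (ha.core hpos).toCore
  have hsymm : T.IsSymmetric := fun x y => (hT y x).symm
  have hnorm : ∀ x : E, (a x x).re = ‖x‖ ^ 2 := fun x => inner_self_eq_norm_sq (𝕜 := ℂ) x
  set e := hsymm.eigenvectorBasis rfl with he
  have hne : Nonempty (Fin (Module.finrank ℂ E)) := by
    have := (Module.finrank_pos_iff_exists_ne_zero (R := ℂ) (M := E)).2 ⟨x, hx⟩
    exact ⟨⟨0, this⟩⟩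
  -- The eigenvalue nearest to `γ` works: in an eigenbasis the residual has coordinates
  -- $(\lambda_l-\gamma)\langle e_l,x\rangle$, and Parseval compares the sums term by term.
  obtain ⟨i, -, hi⟩ := Finset.exists_min_image Finset.univ
    (fun i => ‖γ - (hsymm.eigenvalues rfl i : ℂ)‖) Finset.univ_nonempty
  refine ⟨hsymm.eigenvalues rfl i, (hsymm.hasEigenvalue_eigenvalues rfl i).mem_spectrum, ?_⟩
  rw [hnorm, hnorm, ← e.sum_sq_norm_inner_right x, ← e.sum_sq_norm_inner_right (T x - γ • x),
    Finset.mul_sum]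
  refine Finset.sum_le_sum fun l _ => ?_
  have h1 : inner ℂ (e l) (T x - γ • x)
      = ((hsymm.eigenvalues rfl l : ℂ) - γ) * inner ℂ (e l) x := by
    rw [inner_sub_right, inner_smul_right, sub_mul, ← hsymm, he,
      hsymm.apply_eigenvectorBasis rfl l, inner_smul_left]
    simp
  rw [h1, norm_mul, mul_pow, norm_sub_rev _ γ]
  have := hi l (Finset.mem_univ l)
  gcongr

end HermitianForm

/-! ### Operators on Hilbert spaces -/

section Hilbert

variable {E : Type*} [NormedAddCommGroup E] [InnerProductSpace ℂ E] [CompleteSpace E]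

/-- A symmetric operator that is bounded below is invertible. -/
theorem isUnit_of_isSymmetric_of_bounded_below {S : E →L[ℂ] E}
    (hS : ∀ x y, inner ℂ (S x) y = inner ℂ x (S y)) {c : ℝ} (hc : 0 < c) (h : ∀ x, c * ‖x‖ ≤ ‖S x‖) :
    IsUnit S := by
  have hanti : AntilipschitzWith (Real.toNNReal c⁻¹) S := by
    refine AddMonoidHomClass.antilipschitz_of_bound S fun x => ?_
    rw [Real.coe_toNNReal _ (inv_nonneg.2 hc.le), inv_mul_eq_div, le_div_iff₀ hc, mul_comm]
    exact h x
  rw [ContinuousLinearMap.isUnit_iff_bijective,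
    ContinuousLinearMap.bijective_iff_dense_range_and_antilipschitz]
  refine ⟨?_, ⟨_, hanti⟩⟩
  rw [Submodule.topologicalClosure_eq_top_iff]
  -- The orthogonal complement of the range is the kernel, which the lower bound makes trivial.
  have := LinearMap.IsSymmetric.orthogonal_range (T := (S : E →ₗ[ℂ] E)) hS
  refine this.trans ?_
  exact LinearMap.ker_eq_bot.2 hanti.injective

/-- If `A` is coercive and symmetric, `B` is symmetric and `A K = B`, then `γ` is in the
resolvent set of `K` as soon as `γ - K` is bounded below. -/
theorem exists_inverse_of_bounded_below {A B K : E →L[ℂ] E}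
    (hA : ∀ x y, inner ℂ (A x) y = inner ℂ x (A y))
    (hB : ∀ x y, inner ℂ (B x) y = inner ℂ x (B y)) {c : ℝ} (hc : 0 < c)
    (hcoer : ∀ x, c * ‖x‖ ^ 2 ≤ (inner ℂ (A x) x).re) (hK : ∀ x, A (K x) = B x) {γ : ℂ} {ε : ℝ}
    (hε : 0 < ε) (h : ∀ x, ε * ‖x‖ ≤ ‖K x - γ • x‖) :
    ∃ T : E →L[ℂ] E, (∀ x, T (γ • x - K x) = x) ∧ ∀ x, γ • T x - K (T x) = x := by
  have hAunit : IsUnit A := by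
    refine ContinuousLinearMap.isUnit_of_forall_le_norm_inner_map A (c := ⟨c, hc.le⟩) hc
      fun x => ?_
    rw [mul_comm]
    exact (hcoer x).trans (Complex.re_le_norm _)
  -- `K` is symmetric only for the form of `A`. The operator $S=\gamma A-B=A(\gamma-K)$ is symmetric
  -- for the ambient inner product when `γ` is real, and $S^{-1}A$ inverts $\gamma-K$.
  set S : E →L[ℂ] E := γ • A - B with hSdef
  have hSx : ∀ x, S x = γ • A x - B x := fun x => rfl
  have hSx' : ∀ x, S x = A (γ • x - K x) := by
    intro x
    rw [hSx, map_sub, hK, map_smul]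
  suffices hS : IsUnit S by
    obtain ⟨u, hu⟩ := hS
    obtain ⟨v, hv⟩ := hAunit
    have hinj : Function.Injective A := by
      intro x y hxy
      have := congrArg (fun z => (↑v⁻¹ : E →L[ℂ] E) z) hxy
      simpa only [← hv, ← mul_apply_eq_comp, Units.inv_mul,
        one_apply_eq_self] using this
    have h1 : ∀ x, (↑u⁻¹ : E →L[ℂ] E) (S x) = x := fun x => by
      rw [← hu, ← mul_apply_eq_comp, Units.inv_mul, one_apply_eq_self]
    have h2 : ∀ x, S ((↑u⁻¹ : E →L[ℂ] E) x) = x := fun x => by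
      rw [← hu, ← mul_apply_eq_comp, Units.mul_inv, one_apply_eq_self]
    refine ⟨(↑u⁻¹ : E →L[ℂ] E) * A, fun x => ?_, fun x => hinj ?_⟩
    · rw [mul_apply_eq_comp, ← hSx', h1]
    · rw [← hSx', mul_apply_eq_comp, h2]
  by_cases him : γ.im = 0
  · have hsymm : ∀ x y, inner ℂ (S x) y = inner ℂ x (S y) := by
      intro x y
      rw [hSx, hSx, inner_sub_left, inner_sub_right, inner_smul_left, inner_smul_right, hA, hB,
        Complex.conj_eq_iff_im.2 him]
    refine isUnit_of_isSymmetric_of_bounded_below hsymm (mul_pos hc hε) fun x => ?_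
    have hbelow : ∀ z, c * ‖z‖ ≤ ‖A z‖ := by
      intro z
      rcases eq_or_ne z 0 with rfl | hz
      · simp
      have h1 := (hcoer z).trans ((Complex.re_le_norm _).trans (norm_inner_le_norm (A z) z))
      have hz' : 0 < ‖z‖ := norm_pos_iff.2 hz
      nlinarith
    rw [hSx', mul_assoc]
    refine (mul_le_mul_of_nonneg_left ((h x).trans_eq ?_) hc.le).trans (hbelow _)
    rw [norm_sub_rev]
  -- For nonreal `γ` the imaginary part of $\langle Sx,x\rangle$ is, up to sign,
  -- $\operatorname{Im}\gamma\,\langle Ax,x\rangle$, so `S` is itself coercive.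
  · have hpos : 0 < |γ.im| * c := mul_pos (abs_pos.2 him) hc
    refine ContinuousLinearMap.isUnit_of_forall_le_norm_inner_map S (c := ⟨_, hpos.le⟩) hpos
      fun x => ?_
    have himA : ∀ T : E →L[ℂ] E, (∀ x y, inner ℂ (T x) y = inner ℂ x (T y)) →
        (inner ℂ (T x) x).im = 0 :=
      fun T hT => LinearMap.IsSymmetric.im_inner_apply_self (T := (T : E →ₗ[ℂ] E)) hT x
    have h1 : (inner ℂ (S x) x).im = - (γ.im * (inner ℂ (A x) x).re) := by
      rw [hSx, inner_sub_left, inner_smul_left, Complex.sub_im, Complex.mul_im, himA A hA,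
        himA B hB]
      simp
    refine le_trans ?_ (Complex.abs_im_le_norm _)
    rw [h1, abs_neg, abs_mul, mul_comm]
    change |γ.im| * c * ‖x‖ ^ 2 ≤ _
    rw [mul_assoc]
    exact mul_le_mul_of_nonneg_left ((hcoer x).trans (le_abs_self _)) (abs_nonneg _)

end Hilbert

/-- A lower bound for `K - γ` on a dense set is a lower bound everywhere. -/
theorem bounded_below_of_near {E : Type*} [NormedAddCommGroup E] [InnerProductSpace ℂ E]
    {ι : Type*} {e : ι → E} {K : E →L[ℂ] E} {γ : ℂ} {ε : ℝ}
    (h : ∀ (x : E) (δ : ℝ), 0 < δ →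
      ∃ i, ε * ‖e i‖ ≤ ‖K (e i) - γ • e i‖ ∧ ‖x - e i‖ < δ) (x : E) :
    ε * ‖x‖ ≤ ‖K x - γ • x‖ := by
  have hcl : IsClosed {x : E | ε * ‖x‖ ≤ ‖K x - γ • x‖} :=
    isClosed_le (by fun_prop) (by fun_prop)
  refine hcl.closure_subset (Metric.mem_closure_iff.2 fun δ hδ => ?_)
  obtain ⟨i, hi, hlt⟩ := h x δ hδ
  exact ⟨e i, hi, by rwa [dist_eq_norm]⟩

/-! ### Multiplication operators and pointwise ellipticity -/

/-- Multiplication by a continuous function on `L²`. -/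
def mulL2 {n : ℕ} (m : C(Torus n, ℂ)) : L2 n →L[ℂ] L2 n :=
  (ContinuousLinearMap.mul ℂ ℂ).holderL (torusMeasure n) ⊤ 2 2
    (ContinuousMap.toLp (E := ℂ) ⊤ (torusMeasure n) ℂ m)

theorem coeFn_mulL2 {n : ℕ} (m : C(Torus n, ℂ)) (U : L2 n) :
    mulL2 m U =ᵐ[torusMeasure n] fun y => m y * U y := by
  filter_upwards [(ContinuousLinearMap.mul ℂ ℂ).coeFn_holder
    (ContinuousMap.toLp (E := ℂ) ⊤ (torusMeasure n) ℂ m) U (r := 2),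
    ContinuousMap.coeFn_toLp (p := ⊤) (𝕜 := ℂ) (torusMeasure n) m] with y h1 h2
  refine h1.trans ?_
  rw [h2]
  rfl

theorem inner_mulL2_left {n : ℕ} {m : C(Torus n, ℂ)} (hm : ∀ y, conj (m y) = m y) (U V : L2 n) :
    inner ℂ (mulL2 m U) V = inner ℂ U (mulL2 m V) := by
  rw [L2.inner_def, L2.inner_def]
  refine integral_congr_ae ?_
  filter_upwards [coeFn_mulL2 m U, coeFn_mulL2 m V] with y h1 h2
  rw [h1, h2, RCLike.inner_apply, RCLike.inner_apply, map_mul, hm]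
  ring

/-- The matrix entry `𝒜_{jl}` as a continuous complex function. -/
def entry {d n : ℕ} {𝒜 : Torus n → Matrix (Fin d) (Fin d) ℝ} (h𝒜 : Continuous 𝒜) (j l : Fin d) :
    C(Torus n, ℂ) :=
  ⟨fun y => (𝒜 y j l : ℂ), Complex.continuous_ofReal.comp (h𝒜.matrix_elem j l)⟩

/-- The sesquilinear form `ηᴴ M ζ` of a real matrix. -/
def matForm {d : ℕ} (M : Matrix (Fin d) (Fin d) ℝ) (ζ η : Fin d → ℂ) : ℂ :=
  ∑ j, (∑ l, (M j l : ℂ) * ζ l) * conj (η j)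

theorem matForm_conj {d : ℕ} {M : Matrix (Fin d) (Fin d) ℝ} (hM : M.IsSymm) (ζ η : Fin d → ℂ) :
    conj (matForm M ζ η) = matForm M η ζ := by
  simp only [matForm, map_sum, map_mul, Complex.conj_ofReal, Complex.conj_conj, Finset.sum_mul]
  rw [Finset.sum_comm]
  refine Finset.sum_congr rfl fun j _ => Finset.sum_congr rfl fun l _ => ?_
  rw [← hM.apply l j]
  ring

/-- As `M` is real, products of a real with an imaginary part contribute only to the imaginary part
of the form. Ellipticity for real vectors thus carries over to complex ones. -/
theorem matForm_self_re {d : ℕ} (M : Matrix (Fin d) (Fin d) ℝ) (ζ : Fin d → ℂ) :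
    (matForm M ζ ζ).re = (fun j => (ζ j).re) ⬝ᵥ (M *ᵥ fun j => (ζ j).re)
      + (fun j => (ζ j).im) ⬝ᵥ (M *ᵥ fun j => (ζ j).im) := by
  simp only [matForm, Complex.re_sum, dotProduct, Matrix.mulVec, ← Finset.sum_add_distrib]
  refine Finset.sum_congr rfl fun j _ => ?_
  simp only [Complex.mul_re, Complex.re_sum, Complex.im_sum, Complex.mul_im, Complex.ofReal_re,
    Complex.ofReal_im, Complex.conj_re, Complex.conj_im, zero_mul, sub_zero, add_zero]
  ring

theorem matForm_self_bounds {d : ℕ} {M : Matrix (Fin d) (Fin d) ℝ} {C₀ C₁ : ℝ}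
    (h : ∀ ξ : Fin d → ℝ, C₀ * (ξ ⬝ᵥ ξ) ≤ ξ ⬝ᵥ (M *ᵥ ξ) ∧ ξ ⬝ᵥ (M *ᵥ ξ) ≤ C₁ * (ξ ⬝ᵥ ξ))
    (ζ : Fin d → ℂ) :
    C₀ * ∑ j, ‖ζ j‖ ^ 2 ≤ (matForm M ζ ζ).re ∧ (matForm M ζ ζ).re ≤ C₁ * ∑ j, ‖ζ j‖ ^ 2 := by
  have hn : ∑ j, ‖ζ j‖ ^ 2 = (fun j => (ζ j).re) ⬝ᵥ (fun j => (ζ j).re)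
      + (fun j => (ζ j).im) ⬝ᵥ (fun j => (ζ j).im) := by
    simp only [dotProduct, ← Finset.sum_add_distrib]
    refine Finset.sum_congr rfl fun j _ => ?_
    rw [← Complex.normSq_eq_norm_sq, Complex.normSq_apply]
  have h1 := h fun j => (ζ j).re
  have h2 := h fun j => (ζ j).im
  rw [matForm_self_re, hn, mul_add, mul_add]
  exact ⟨add_le_add h1.1 h2.1, add_le_add h1.2 h2.2⟩

/-! ### The operator of the form `a` and the solution operator -/

section FormOperator

variable {d n : ℕ} (P : Matrix (Fin d) (Fin n) ℝ) {𝒜 : Torus n → Matrix (Fin d) (Fin d) ℝ}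
  (h𝒜 : Continuous 𝒜)

/-- The `j`-th component of `𝒜 P∇U`. -/
def flux (j : Fin d) : H1P P →L[ℂ] L2 n := ∑ l, mulL2 (entry h𝒜 j l) ∘L gradL P l

/-- The operator of `(U, V)` on `H¹_P`. -/
def massOp : H1P P →L[ℂ] H1P P :=
  ContinuousLinearMap.adjoint (𝕜 := ℂ) (E := H1P P) (F := L2 n) (toL2L P) ∘L toL2L P

/-- The operator of the form `a` on `H¹_P`. -/
def formOp : H1P P →L[ℂ] H1P P := 
  ∑ j, ContinuousLinearMap.adjoint (𝕜 := ℂ) (E := H1P P) (F := L2 n) (gradL P j) ∘L flux P h𝒜 j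
    + massOp P

theorem flux_apply (j : Fin d) (U : H1P P) :
    flux P h𝒜 j U = ∑ l, mulL2 (entry h𝒜 j l) (weakGrad U l) := by
  simp [flux, gradL_apply]

theorem coeFn_flux (j : Fin d) (U : H1P P) :
    flux P h𝒜 j U =ᵐ[torusMeasure n] fun y => ∑ l, (𝒜 y j l : ℂ) * weakGrad U l y := by
  rw [flux_apply]
  have h1 := Lp.coeFn_finsetSum Finset.univ fun l => mulL2 (entry h𝒜 j l) (weakGrad U l)
  have h2 := ae_all_iff.2 fun l => coeFn_mulL2 (entry h𝒜 j l) (weakGrad U l)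
  filter_upwards [h1, h2] with y h1 h2
  rw [h1, Finset.sum_apply]
  exact Finset.sum_congr rfl fun l _ => h2 l

theorem inner_massOp (U V : H1P P) :
    inner ℂ V (massOp P U) = inner ℂ (toL2 V) (toL2 U) := by
  exact ContinuousLinearMap.adjoint_inner_right (𝕜 := ℂ) (E := H1P P) (F := L2 n) _ _ _

theorem inner_massOp_eq_innerL2 (U V : H1P P) :
    inner ℂ V (massOp P U) = innerL2 (fun y => toL2 U y) (fun y => toL2 V y) := by
  rw [inner_massOp, L2.inner_def]
  rfl

theorem inner_formOp (U V : H1P P) :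
    inner ℂ V (formOp P h𝒜 U)
      = ∑ j, inner ℂ (weakGrad V j) (flux P h𝒜 j U) + inner ℂ (toL2 V) (toL2 U) := by
  have h1 : formOp P h𝒜 U = ∑ j, ContinuousLinearMap.adjoint (𝕜 := ℂ) (E := H1P P) (F := L2 n)
      (gradL P j) (flux P h𝒜 j U) + massOp P U := by
    simp only [formOp, _root_.add_apply, _root_.sum_apply,
      ContinuousLinearMap.comp_apply]
  rw [h1, inner_add_right (𝕜 := ℂ) (E := H1P P), inner_massOp, inner_sum (𝕜 := ℂ) (E := H1P P)]
  congr 1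
  exact Finset.sum_congr rfl fun j _ =>
    ContinuousLinearMap.adjoint_inner_right (𝕜 := ℂ) (E := H1P P) (F := L2 n) _ _ _

theorem inner_formOp_eq_formA (U V : H1P P) :
    inner ℂ V (formOp P h𝒜 U) = formA P 𝒜 U V := by
  rw [inner_formOp, formA]
  congr 1
  refine Finset.sum_congr rfl fun j _ => ?_
  rw [L2.inner_def]
  refine integral_congr_ae ?_
  filter_upwards [coeFn_flux P h𝒜 j U] with y hy
  rw [hy, RCLike.inner_apply]

theorem isSymmetric_massOp : 
    ∀ U V : H1P P, inner ℂ (massOp P U) V = inner ℂ U (massOp P V) := by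
  intro U V
  rw [← inner_conj_symm (𝕜 := ℂ) (E := H1P P), inner_massOp, inner_massOp, inner_conj_symm]

theorem isSymmetric_formOp (hsymm : ∀ y, (𝒜 y).IsSymm) :
    ∀ U V : H1P P, inner ℂ (formOp P h𝒜 U) V = inner ℂ U (formOp P h𝒜 V) := by
  intro U V
  rw [← inner_conj_symm (𝕜 := ℂ) (E := H1P P), inner_formOp, inner_formOp]
  simp only [map_add, map_sum, inner_conj_symm, flux_apply, inner_sum]
  congr 1
  rw [Finset.sum_comm]
  refine Finset.sum_congr rfl fun l _ => Finset.sum_congr rfl fun j _ => ?_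
  rw [inner_mulL2_left fun y => Complex.conj_ofReal _]
  have : entry h𝒜 j l = entry h𝒜 l j := by
    ext y
    exact congrArg Complex.ofReal ((hsymm y).apply l j)
  rw [this]

theorem formOp_coercive {C₀ C₁ : ℝ} (hell : ∀ (y : Torus n) (ξ : Fin d → ℝ),
      C₀ * (ξ ⬝ᵥ ξ) ≤ ξ ⬝ᵥ (𝒜 y *ᵥ ξ) ∧ ξ ⬝ᵥ (𝒜 y *ᵥ ξ) ≤ C₁ * (ξ ⬝ᵥ ξ)) (U : H1P P) :
    min C₀ 1 * ‖U‖ ^ 2 ≤ (inner ℂ (formOp P h𝒜 U) U).re := by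
  have hgrad : C₀ * ∑ j, ‖weakGrad U j‖ ^ 2
      ≤ (∑ j, inner ℂ (weakGrad U j) (flux P h𝒜 j U)).re := by
    -- The integrand is the pointwise form of $\mathcal A-C_0$, whose real part is nonnegative by
    -- ellipticity.
    have h1 : 0 ≤ (∑ j, inner ℂ (weakGrad U j) (flux P h𝒜 j U - (C₀ : ℂ) • weakGrad U j)).re := by
      simp only [L2.inner_def]
      rw [← integral_finsetSum _ fun j _ => L2.integrable_inner _ _]
      have hint : Integrable (fun y => ∑ j, inner ℂ (weakGrad U j y)
          ((flux P h𝒜 j U - (C₀ : ℂ) • weakGrad U j : L2 n) y)) (torusMeasure n) :=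
        integrable_finsetSum _ fun j _ => L2.integrable_inner _ _
      refine le_of_le_of_eq ?_ (integral_re hint)
      refine integral_nonneg_of_ae ?_
      have h2 := ae_all_iff.2 fun j => coeFn_flux P h𝒜 j U
      have h3 := ae_all_iff.2 fun j => Lp.coeFn_sub (flux P h𝒜 j U) ((C₀ : ℂ) • weakGrad U j)
      have h4 := ae_all_iff.2 fun j => Lp.coeFn_smul (C₀ : ℂ) (weakGrad U j)
      filter_upwards [h2, h3, h4] with y h2 h3 h4
      have h5 := (matForm_self_bounds (hell y) fun j => weakGrad U j y).1
      have h6 : ∑ j, inner ℂ (weakGrad U j y)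
          ((flux P h𝒜 j U - (C₀ : ℂ) • weakGrad U j : L2 n) y)
          = matForm (𝒜 y) (fun j => weakGrad U j y) (fun j => weakGrad U j y)
            - ((C₀ * ∑ j, ‖weakGrad U j y‖ ^ 2 : ℝ) : ℂ) := by
        rw [matForm, Complex.ofReal_mul, Complex.ofReal_sum, Finset.mul_sum,
          ← Finset.sum_sub_distrib]
        refine Finset.sum_congr rfl fun j _ => ?_
        rw [h3 j, Pi.sub_apply, h2 j, h4 j, Pi.smul_apply, RCLike.inner_apply, sub_mul,
          smul_eq_mul, mul_assoc (C₀ : ℂ), Complex.mul_conj, Complex.normSq_eq_norm_sq]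
      rw [h6]
      change 0 ≤ (_ - Complex.ofReal _ : ℂ).re
      rw [Complex.sub_re, Complex.ofReal_re]
      exact sub_nonneg.2 h5
    simp only [inner_sub_right, inner_smul_right, Finset.sum_sub_distrib, Complex.sub_re,
      ← Finset.mul_sum, Complex.re_ofReal_mul] at h1
    have h2 : (∑ j, inner ℂ (weakGrad U j) (weakGrad U j)).re = ∑ j, ‖weakGrad U j‖ ^ 2 := by
      rw [Complex.re_sum]
      exact Finset.sum_congr rfl fun j _ => inner_self_eq_norm_sq (𝕜 := ℂ) _
    rw [h2] at h1
    linarith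
  have hre : (inner ℂ (formOp P h𝒜 U) U).re = (inner ℂ U (formOp P h𝒜 U)).re :=
    inner_re_symm (𝕜 := ℂ) (E := H1P P) _ _
  have hmass : (inner ℂ (toL2 U) (toL2 U)).re = ‖toL2 U‖ ^ 2 := inner_self_eq_norm_sq (𝕜 := ℂ) _
  rw [hre, inner_formOp, Complex.add_re, hmass, norm_sq_H1P, mul_add, add_comm]
  refine add_le_add ?_ ?_
  · exact (mul_le_mul_of_nonneg_right (min_le_left _ _)
      (Finset.sum_nonneg fun j _ => sq_nonneg _)).trans hgrad
  · exact (mul_le_mul_of_nonneg_right (min_le_right _ _) (sq_nonneg _)).trans_eq (one_mul _)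

/-- Replaces the variational identity by the operator equation $AK=B$; existence and uniqueness then
amount to inverting $A$. -/
theorem isSolutionOperator_iff (K : H1P P →L[ℂ] H1P P) :
    IsSolutionOperator P 𝒜 K ↔ formOp P h𝒜 * K = massOp P := by
  simp only [IsSolutionOperator, ← inner_formOp_eq_formA P h𝒜, ← inner_massOp_eq_innerL2]
  constructor
  · intro h
    ext1 F
    exact ext_inner_left (𝕜 := ℂ) (E := H1P P) fun V => h F V
  · intro h F V
    rw [← h]
    rfl

theorem existsUnique_isSolutionOperator (h𝒜 : Continuous 𝒜) {C₀ C₁ : ℝ} (hC₀ : 0 < C₀)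
    (hell : ∀ (y : Torus n) (ξ : Fin d → ℝ),
      C₀ * (ξ ⬝ᵥ ξ) ≤ ξ ⬝ᵥ (𝒜 y *ᵥ ξ) ∧ ξ ⬝ᵥ (𝒜 y *ᵥ ξ) ≤ C₁ * (ξ ⬝ᵥ ξ)) :
    ∃! K : H1P P →L[ℂ] H1P P, IsSolutionOperator P 𝒜 K := by
  have hc : 0 < min C₀ 1 := lt_min hC₀ one_pos
  have hunit : IsUnit (formOp P h𝒜) := by
    refine ContinuousLinearMap.isUnit_of_forall_le_norm_inner_map (𝕜 := ℂ) (E := H1P P) _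
      (c := ⟨_, hc.le⟩) hc fun x => ?_
    rw [mul_comm]
    exact (formOp_coercive P h𝒜 hell x).trans (Complex.re_le_norm _)
  obtain ⟨u, hu⟩ := hunit
  simp only [isSolutionOperator_iff P h𝒜, ← hu]
  exact ⟨(↑u⁻¹ : H1P P →L[ℂ] H1P P) * massOp P, Units.mul_inv_cancel_left u _,
    fun K hK => by rw [← hK, Units.inv_mul_cancel_left]⟩

/-- A bounded two-sided inverse of `γ - K` excludes `γ` from the spectrum. -/
theorem notMem_spectrum_of_inverse {γ : ℂ} {K T : H1P P →L[ℂ] H1P P}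
    (h1 : ∀ x, T (γ • x - K x) = x) (h2 : ∀ x, γ • T x - K (T x) = x) : γ ∉ spectrum ℂ K := by
  refine fun hγ => hγ ?_
  rw [spectrum.mem_resolventSet_iff, Algebra.algebraMap_eq_smul_one]
  exact ⟨⟨γ • 1 - K, T, ContinuousLinearMap.ext h2, ContinuousLinearMap.ext h1⟩, rfl⟩

theorem exists_inverse_solutionOperator (h𝒜 : Continuous 𝒜) {C₀ C₁ : ℝ} (hC₀ : 0 < C₀)
    (hsymm : ∀ y, (𝒜 y).IsSymm) (hell : ∀ (y : Torus n) (ξ : Fin d → ℝ),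
      C₀ * (ξ ⬝ᵥ ξ) ≤ ξ ⬝ᵥ (𝒜 y *ᵥ ξ) ∧ ξ ⬝ᵥ (𝒜 y *ᵥ ξ) ≤ C₁ * (ξ ⬝ᵥ ξ))
    {K : H1P P →L[ℂ] H1P P} (hK : IsSolutionOperator P 𝒜 K) {γ : ℂ} {ε : ℝ} (hε : 0 < ε)
    (hbelow : ∀ x : H1P P, ε * ‖x‖ ≤ ‖K x - γ • x‖) :
    ∃ T : H1P P →L[ℂ] H1P P, (∀ x, T (γ • x - K x) = x) ∧ ∀ x, γ • T x - K (T x) = x := by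
  have hAK : ∀ x, formOp P h𝒜 (K x) = massOp P x := fun x =>
    congrArg (fun T : H1P P →L[ℂ] H1P P => T x) ((isSolutionOperator_iff P h𝒜 K).1 hK)
  have key := @exists_inverse_of_bounded_below (H1P P) _ _ _ (formOp P h𝒜) (massOp P) K
    (isSymmetric_formOp P h𝒜 hsymm) (isSymmetric_massOp P) (min C₀ 1)
  exact @key (lt_min hC₀ one_pos) (formOp_coercive P h𝒜 hell) hAK γ ε hε hbelow

/-- Points of the spectrum of the solution operator have approximate eigenvectors that are
trigonometric polynomials. -/
theorem exists_trigPoly_approx_eigenvector (h𝒜 : Continuous 𝒜) {C₀ C₁ : ℝ} (hC₀ : 0 < C₀)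
    (hsymm : ∀ y, (𝒜 y).IsSymm) (hell : ∀ (y : Torus n) (ξ : Fin d → ℝ),
      C₀ * (ξ ⬝ᵥ ξ) ≤ ξ ⬝ᵥ (𝒜 y *ᵥ ξ) ∧ ξ ⬝ᵥ (𝒜 y *ᵥ ξ) ≤ C₁ * (ξ ⬝ᵥ ξ))
    {K : H1P P →L[ℂ] H1P P} (hK : IsSolutionOperator P 𝒜 K) {γ : ℂ} (hγ : γ ∈ spectrum ℂ K)
    {ε : ℝ} (hε : 0 < ε) :
    ∃ φ ∈ trigPoly n, ‖K (embed P φ) - γ • embed P φ‖ < ε * ‖embed P φ‖ := by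
  -- If no such polynomial existed, density would spread the lower bound for $K-\gamma$ to all of
  -- $H^1_P$ and put `γ` in the resolvent set.
  by_contra hcon
  push Not at hcon
  have hbelow : ∀ x : H1P P, ε * ‖x‖ ≤ ‖K x - γ • x‖ :=
    bounded_below_of_near (E := H1P P) (e := fun φ : trigPoly n => embed P φ) fun x δ hδ => by
      obtain ⟨φ, hφ, hlt⟩ := exists_trigPoly_near P x hδ
      exact ⟨⟨φ, hφ⟩, hcon φ hφ, hlt⟩
  obtain ⟨T, hT1, hT2⟩ := exists_inverse_solutionOperator P h𝒜 hC₀ hsymm hell hK hε hbelow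
  exact notMem_spectrum_of_inverse P hT1 hT2 hγ

end FormOperator

/-! ### Trigonometric polynomials -/

theorem trigSpace_le_testSpace (n N : ℕ) : trigSpace n N ≤ testSpace n := by
  refine Submodule.span_le.2 ?_
  rintro _ ⟨k, -, rfl⟩
  exact isTestFunction_character k

/-- The inclusion of `V^N` into the smooth functions. -/
def trigIncl (n N : ℕ) : trigSpace n N →ₗ[ℂ] testSpace n :=
  Submodule.inclusion (trigSpace_le_testSpace n N)

/-- Characters are eigenfunctions of $P\nabla$, so $V^N$ is invariant and exactness of the grid sum
applies to gradients too. -/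
theorem testGrad_mem_trigSpace {d n N : ℕ} (P : Matrix (Fin d) (Fin n) ℝ) (j : Fin d)
    {φ : testSpace n} (hφ : (φ : C(Torus n, ℂ)) ∈ trigSpace n N) :
    testGrad P j φ ∈ trigSpace n N := by
  suffices h : ∀ (f : C(Torus n, ℂ)) (hf : f ∈ trigSpace n N),
      testGrad P j ⟨f, trigSpace_le_testSpace n N hf⟩ ∈ trigSpace n N from h φ hφ
  intro f hf
  induction hf using Submodule.span_induction with
  | mem f hf =>
    obtain ⟨k, hk, rfl⟩ := hf
    exact (testGrad_charTest P k j).symm ▸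
      Submodule.smul_mem _ _ (Submodule.subset_span ⟨k, hk, rfl⟩)
  | zero => exact ((testGrad P j).map_zero).symm ▸ Submodule.zero_mem _
  | add f g hf hg ihf ihg =>
    have := (testGrad P j).map_add ⟨f, trigSpace_le_testSpace n N hf⟩
      ⟨g, trigSpace_le_testSpace n N hg⟩
    exact this.symm ▸ Submodule.add_mem _ ihf ihg
  | smul c f hf ih =>
    have := (testGrad P j).map_smul c ⟨f, trigSpace_le_testSpace n N hf⟩
    exact this.symm ▸ Submodule.smul_mem _ c ih

theorem finite_freqSet (n N : ℕ) : (freqSet n N).Finite := by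
  refine (Set.finite_Icc (fun _ : Fin n => -(N : ℤ)) (fun _ => (N : ℤ))).subset fun k hk => ?_
  rw [Set.mem_Icc, Pi.le_def, Pi.le_def]
  have hN : (0 : ℝ) ≤ N := N.cast_nonneg
  refine ⟨fun i => ?_, fun i => ?_⟩
  · have := (hk i).1
    have h : (-(N : ℝ)) ≤ k i := by linarith
    exact_mod_cast h
  · have := (hk i).2
    have h : (k i : ℝ) ≤ N := by linarith
    exact_mod_cast h

instance instFiniteDimensionalTrigSpace (n N : ℕ) : FiniteDimensional ℂ (trigSpace n N) :=
  FiniteDimensional.span_of_finite ℂ ((finite_freqSet n N).image _)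

theorem eventually_mem_freqSet {n : ℕ} (k : Fin n → ℤ) : ∀ᶠ N : ℕ in atTop, k ∈ freqSet n N := by
  refine eventually_all.2 fun i => ?_
  have h := (tendsto_natCast_atTop_atTop (R := ℝ)).eventually_gt_atTop (2 * |(k i : ℝ)|)
  filter_upwards [h] with N hN
  constructor
  · linarith [neg_abs_le (k i : ℝ)]
  · linarith [le_abs_self (k i : ℝ)]

theorem eventually_mem_trigSpace {n : ℕ} {f : C(Torus n, ℂ)}
    (hf : f ∈ Submodule.span ℂ (Set.range (character (n := n)))) :
    ∀ᶠ N in atTop, f ∈ trigSpace n N := by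
  induction hf using Submodule.span_induction with
  | mem f hf =>
    obtain ⟨k, rfl⟩ := hf
    filter_upwards [eventually_mem_freqSet k] with N hN
    exact Submodule.subset_span ⟨k, hN, rfl⟩
  | zero => exact Eventually.of_forall fun N => Submodule.zero_mem _
  | add f g _ _ hf hg =>
    filter_upwards [hf, hg] with N h1 h2
    exact Submodule.add_mem _ h1 h2
  | smul c f _ hf =>
    filter_upwards [hf] with N h1
    exact Submodule.smul_mem _ c h1

theorem eventually_coe_mem_trigSpace {n : ℕ} {φ : testSpace n} (hφ : φ ∈ trigPoly n) :
    ∀ᶠ N in atTop, (φ : C(Torus n, ℂ)) ∈ trigSpace n N := by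
  refine eventually_mem_trigSpace ?_
  have h := Submodule.mem_map_of_mem (f := (testSpace n).subtype) hφ
  rwa [trigPoly, Submodule.map_span, ← Set.range_comp] at h

/-! ### The discrete inner product -/

theorem innerGrid_add_left {n : ℕ} (N : ℕ) (F G H : Torus n → ℂ) :
    innerGrid N (F + G) H = innerGrid N F H + innerGrid N G H := by
  simp only [innerGrid, Pi.add_apply, add_mul, Finset.sum_add_distrib, mul_add]

theorem innerGrid_smul_left {n : ℕ} (N : ℕ) (c : ℂ) (F G : Torus n → ℂ) :
    innerGrid N (c • F) G = c * innerGrid N F G := by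
  simp only [innerGrid, Pi.smul_apply, smul_eq_mul, mul_assoc, ← Finset.mul_sum]
  ring

theorem innerGrid_conj {n : ℕ} (N : ℕ) (F G : Torus n → ℂ) :
    conj (innerGrid N F G) = innerGrid N G F := by
  simp only [innerGrid, map_mul, map_div₀, map_one, map_pow, map_natCast, map_sum,
    Complex.conj_conj, mul_comm]

theorem isHermitianForm_innerGrid (n N : ℕ) :
    IsHermitianForm fun F G : C(Torus n, ℂ) => innerGrid N F G where
  add_left F G H := innerGrid_add_left N F G H
  smul_left c F G := innerGrid_smul_left N c F G
  symm F G := innerGrid_conj N F G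

theorem isHermitianForm_innerL2 (n : ℕ) :
    IsHermitianForm fun F G : C(Torus n, ℂ) => innerL2 F G where
  add_left F G H := by simp only [← inner_contToL2, map_add, inner_add_right]
  smul_left c F G := by simp only [← inner_contToL2, map_smul, inner_smul_right]
  symm F G := by simp only [← inner_contToL2, inner_conj_symm]

/-- A full geometric sum of powers of an $N$-th root of unity other than one. -/
theorem sum_exp_eq_zero {N : ℕ} (hN : 0 < N) {k : ℤ} (hk : ¬ (N : ℤ) ∣ k) :
    ∑ j : Fin N, Complex.exp (Complex.I * ((k * (2 * π * ((j : ℕ) : ℝ) / N) : ℝ) : ℂ)) = 0 := by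
  have hN' : (N : ℂ) ≠ 0 := by exact_mod_cast hN.ne'
  set z : ℂ := Complex.exp (2 * π * Complex.I * (k / N)) with hz
  have hterm : ∀ j : ℕ, Complex.exp (Complex.I * ((k * (2 * π * ((j : ℕ) : ℝ) / N) : ℝ) : ℂ))
      = z ^ j := by
    intro j
    rw [hz, ← Complex.exp_nat_mul]
    congr 1
    push_cast
    field_simp
  have hz1 : z ≠ 1 := by
    intro h
    obtain ⟨m, hm⟩ := Complex.exp_eq_one_iff.1 h
    refine hk ⟨m, ?_⟩
    have hpi : (2 * π * Complex.I : ℂ) ≠ 0 := Complex.two_pi_I_ne_zero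
    rw [mul_comm (m : ℂ)] at hm
    have h2 := mul_left_cancel₀ hpi hm
    rw [div_eq_iff hN'] at h2
    have h3 : k = m * N := by exact_mod_cast h2
    rw [h3, mul_comm]
  have hzN : z ^ N = 1 := by
    rw [hz, ← Complex.exp_nat_mul]
    refine Complex.exp_eq_one_iff.2 ⟨k, ?_⟩
    field_simp
  simp only [hterm]
  rw [Fin.sum_univ_eq_sum_range (fun j => z ^ j), geom_sum_eq hz1, hzN, sub_self, zero_div]

theorem innerGrid_character_of_ne {n N : ℕ} (hN : 0 < N) {k l : Fin n → ℤ} {i : Fin n}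
    (hi : ¬ (N : ℤ) ∣ k i - l i) : innerGrid N (character k) (character l) = 0 := by
  have h1 : ∀ j : Fin n → Fin N,
      character k (gridPoint j) * conj (character l (gridPoint j))
        = ∏ i, Complex.exp
          (Complex.I * (((k i - l i : ℤ) * (2 * π * ((j i : ℕ) : ℝ) / N) : ℝ) : ℂ)) := by
    intro j
    rw [← character_neg_apply, ← ContinuousMap.mul_apply, ← character_add, ← sub_eq_add_neg,
      gridPoint, character_toTorus, ← Complex.exp_sum]
    congr 1
    rw [Complex.ofReal_sum, Finset.mul_sum]
    rfl
  simp only [innerGrid, h1]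
  have h2 := Finset.prod_univ_sum (fun _ : Fin n => (Finset.univ : Finset (Fin N)))
    (fun i (j : Fin N) => Complex.exp
      (Complex.I * (((k i - l i : ℤ) * (2 * π * ((j : ℕ) : ℝ) / N) : ℝ) : ℂ)))
  rw [Fintype.piFinset_univ] at h2
  rw [← h2, Finset.prod_eq_zero (Finset.mem_univ i) (sum_exp_eq_zero hN hi), mul_zero]

theorem innerGrid_character_self {n N : ℕ} (hN : 0 < N) (k : Fin n → ℤ) :
    innerGrid N (character k) (character k) = 1 := by
  have hN' : (N : ℂ) ^ n ≠ 0 := pow_ne_zero _ (by exact_mod_cast hN.ne')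
  simp only [innerGrid, Complex.mul_conj, Complex.normSq_eq_norm_sq, norm_character_apply]
  simp only [one_pow, Complex.ofReal_one, Finset.sum_const, Finset.card_univ, Fintype.card_fun,
    Fintype.card_fin, nsmul_eq_mul, mul_one]
  push_cast
  field_simp

theorem innerL2_character {n : ℕ} (k l : Fin n → ℤ) :
    innerL2 (character k) (character l) = if k = l then 1 else 0 := by
  simp only [innerL2, ← character_neg_apply, ← ContinuousMap.mul_apply, ← character_add,
    integral_character, ← sub_eq_add_neg, sub_eq_zero]

theorem innerGrid_character_eq {n N : ℕ} (hN : 0 < N) {k l : Fin n → ℤ} (hk : k ∈ freqSet n N)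
    (hl : l ∈ freqSet n N) :
    innerGrid N (character k) (character l) = innerL2 (character k) (character l) := by
  rw [innerL2_character]
  split_ifs with h
  · rw [h, innerGrid_character_self hN]
  · obtain ⟨i, hi⟩ := Function.ne_iff.1 h
    refine innerGrid_character_of_ne hN (i := i) fun hdvd => hi ?_
    refine sub_eq_zero.1 (Int.eq_zero_of_abs_lt_dvd hdvd ?_)
    -- The half-open box makes this strict; with both endpoints $\pm N/2$ allowed, a difference of
    -- $N$ would alias.
    have h1 : |((k i - l i : ℤ) : ℝ)| < N := by
      push_cast
      have := hk i
      have := hl i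
      rw [abs_lt]
      constructor <;> linarith
    exact_mod_cast h1

/-- On `V^N` the discrete inner product is the `L²` inner product. -/
theorem innerGrid_eq_innerL2 {n N : ℕ} (hN : 0 < N) {F G : C(Torus n, ℂ)}
    (hF : F ∈ trigSpace n N) (hG : G ∈ trigSpace n N) : innerGrid N F G = innerL2 F G := by
  have hg := isHermitianForm_innerGrid n N
  have hl := isHermitianForm_innerL2 n
  induction hF using Submodule.span_induction with
  | mem F hF =>
    obtain ⟨k, hk, rfl⟩ := hF
    induction hG using Submodule.span_induction with
    | mem G hG =>
      obtain ⟨l, hl, rfl⟩ := hG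
      exact innerGrid_character_eq hN hk hl
    | zero =>
      have h1 := hg.smul_right 0 (character k) 0
      have h2 := hl.smul_right 0 (character k) 0
      simp only [map_zero, zero_mul, smul_zero] at h1 h2
      exact h1.trans h2.symm
    | add x y _ _ hx hy =>
      exact (hg.add_right _ x y).trans ((congrArg₂ _ hx hy).trans (hl.add_right _ x y).symm)
    | smul c x _ hx =>
      exact (hg.smul_right c _ x).trans ((congrArg _ hx).trans (hl.smul_right c _ x).symm)
  | zero =>
    have h1 := hg.smul_left 0 0 G
    have h2 := hl.smul_left 0 0 G
    simp only [zero_mul, smul_zero] at h1 h2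
    exact h1.trans h2.symm
  | add x y _ _ hx hy =>
    exact (hg.add_left x y _).trans ((congrArg₂ _ hx hy).trans (hl.add_left x y _).symm)
  | smul c x _ hx =>
    exact (hg.smul_left c x _).trans ((congrArg _ hx).trans (hl.smul_left c x _).symm)

theorem innerGrid_self_re {n : ℕ} (N : ℕ) (F : Torus n → ℂ) :
    (innerGrid N F F).re = 1 / (N : ℝ) ^ n * ∑ j : Fin n → Fin N, ‖F (gridPoint j)‖ ^ 2 := by
  have : innerGrid N F F
      = ((1 / (N : ℝ) ^ n * ∑ j : Fin n → Fin N, ‖F (gridPoint j)‖ ^ 2 : ℝ) : ℂ) := by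
    simp only [innerGrid, Complex.mul_conj, Complex.normSq_eq_norm_sq]
    push_cast
    rfl
  rw [this, Complex.ofReal_re]

theorem innerGrid_self_re_eq_norm_sq {n N : ℕ} (hN : 0 < N) {F : C(Torus n, ℂ)}
    (hF : F ∈ trigSpace n N) : (innerGrid N F F).re = ‖contToL2 n F‖ ^ 2 := by
  rw [innerGrid_eq_innerL2 hN hF hF, ← inner_contToL2]
  exact inner_self_eq_norm_sq (𝕜 := ℂ) _

/-- Cauchy–Schwarz on the grid leaves the discrete norm of `W`, which is its $L^2$ norm by
exactness. Only `W` has to lie in $V^N$, and the bound does not depend on `N`. -/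
theorem norm_innerGrid_le {n N : ℕ} (hN : 0 < N) (R : C(Torus n, ℂ)) {W : C(Torus n, ℂ)}
    (hW : W ∈ trigSpace n N) : ‖innerGrid N R W‖ ≤ ‖R‖ * ‖contToL2 n W‖ := by
  have hNpos : (0 : ℝ) < (N : ℝ) ^ n := pow_pos (by exact_mod_cast hN) n
  have h1 : ‖innerGrid N R W‖
      ≤ ‖R‖ * (1 / (N : ℝ) ^ n * ∑ j : Fin n → Fin N, ‖W (gridPoint j)‖) := by
    rw [innerGrid, norm_mul, norm_div, norm_one, norm_pow, Complex.norm_natCast, mul_left_comm]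
    refine mul_le_mul_of_nonneg_left ?_ (by positivity)
    rw [Finset.mul_sum]
    refine (norm_sum_le _ _).trans (Finset.sum_le_sum fun j _ => ?_)
    rw [norm_mul, RCLike.norm_conj]
    exact mul_le_mul_of_nonneg_right (R.norm_coe_le_norm _) (norm_nonneg _)
  refine h1.trans (mul_le_mul_of_nonneg_left ?_ (norm_nonneg _))
  refine le_of_sq_le_sq ?_ (norm_nonneg _)
  rw [← innerGrid_self_re_eq_norm_sq hN hW, innerGrid_self_re, mul_pow]
  have h2 := sq_sum_le_card_mul_sum_sq (s := (Finset.univ : Finset (Fin n → Fin N)))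
    (f := fun j => ‖W (gridPoint j)‖)
  rw [Finset.card_univ, Fintype.card_fun, Fintype.card_fin, Fintype.card_fin, Nat.cast_pow] at h2
  refine (mul_le_mul_of_nonneg_left h2 (by positivity)).trans_eq ?_
  field_simp

theorem norm_contToL2_le {n : ℕ} (R : C(Torus n, ℂ)) : ‖contToL2 n R‖ ≤ ‖R‖ := by
  refine ((contToL2 n).le_opNorm R).trans ?_
  have h : ‖contToL2 n‖ ≤ 1 := by
    refine (ContinuousMap.toLp_norm_le (p := 2) (μ := torusMeasure n) (E := ℂ) (𝕜 := ℂ)).trans ?_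
    simp [measureUnivNNReal]
  exact mul_le_of_le_one_left (norm_nonneg _) h

/-- The discrete inner product is consistent with the `L²` inner product, uniformly in the
trigonometric polynomial in the second slot. -/
theorem eventually_norm_innerL2_sub_innerGrid_le {n : ℕ} (G : C(Torus n, ℂ)) {ε : ℝ}
    (hε : 0 < ε) : ∀ᶠ N in atTop, ∀ W ∈ trigSpace n N,
      ‖innerL2 G W - innerGrid N G W‖ ≤ ε * ‖contToL2 n W‖ := by
  have hG : G ∈ closure (Submodule.span ℂ (Set.range (character (n := n))) : Set _) := by
    have h : G ∈ (Submodule.span ℂ (Set.range (character (n := n)))).topologicalClosure := by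
      rw [span_character_closure_eq_top]
      trivial
    exact h
  -- Once `Q` lies in $V^N$ it contributes no error, and $G-Q$ contributes at most $\varepsilon/2$
  -- through each of the two inner products.
  obtain ⟨Q, hQ, hlt⟩ := Metric.mem_closure_iff.1 hG (ε / 2) (half_pos hε)
  rw [dist_eq_norm] at hlt
  filter_upwards [eventually_mem_trigSpace hQ, eventually_gt_atTop 0] with N hQN hN W hW
  have h1 := (isHermitianForm_innerGrid n N).sub_left G Q W
  have h2 := (isHermitianForm_innerL2 n).sub_left G Q W
  have h3 := innerGrid_eq_innerL2 hN hQN hW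
  have h4 : innerL2 G W - innerGrid N G W = innerL2 (G - Q : C(Torus n, ℂ)) W
      - innerGrid N (G - Q : C(Torus n, ℂ)) W := by
    refine Eq.trans ?_ (congrArg₂ _ h2 h1).symm
    rw [h3]
    ring
  have h5 : ‖innerL2 (G - Q : C(Torus n, ℂ)) W‖ ≤ ‖G - Q‖ * ‖contToL2 n W‖ := by
    rw [← inner_contToL2]
    exact ((norm_inner_le_norm _ _).trans
      (mul_le_mul_of_nonneg_left (norm_contToL2_le _) (norm_nonneg _))).trans_eq (mul_comm _ _)
  rw [h4]
  refine (norm_sub_le _ _).trans ((add_le_add h5 (norm_innerGrid_le hN (G - Q) hW)).trans ?_)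
  rw [← add_mul]
  exact mul_le_mul_of_nonneg_right (by linarith) (norm_nonneg _)

/-! ### The discrete form -/

theorem matForm_add_left {d : ℕ} (M : Matrix (Fin d) (Fin d) ℝ) (ζ ζ' η : Fin d → ℂ) :
    matForm M (ζ + ζ') η = matForm M ζ η + matForm M ζ' η := by
  simp only [matForm, Pi.add_apply, mul_add, Finset.sum_add_distrib, add_mul]

theorem matForm_smul_left {d : ℕ} (M : Matrix (Fin d) (Fin d) ℝ) (c : ℂ) (ζ η : Fin d → ℂ) :
    matForm M (c • ζ) η = c * matForm M ζ η := by
  simp only [matForm, Pi.smul_apply, smul_eq_mul, Finset.mul_sum, Finset.sum_mul]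
  exact Finset.sum_congr rfl fun j _ => Finset.sum_congr rfl fun l _ => by ring

section FormGrid

variable {d n : ℕ} (P : Matrix (Fin d) (Fin n) ℝ) {𝒜 : Torus n → Matrix (Fin d) (Fin d) ℝ}

theorem formGrid_eq_sum (𝒜 : Torus n → Matrix (Fin d) (Fin d) ℝ) (N : ℕ) (U V : Torus n → ℂ) :
    formGrid P 𝒜 N U V = 1 / (N : ℂ) ^ n * ∑ j : Fin n → Fin N,
      (matForm (𝒜 (gridPoint j)) (projGrad P U (gridPoint j)) (projGrad P V (gridPoint j))
        + U (gridPoint j) * conj (V (gridPoint j))) := by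
  simp only [formGrid, innerGrid, matForm]
  rw [← Finset.mul_sum, Finset.sum_comm, ← mul_add, ← Finset.sum_add_distrib]

theorem isHermitianForm_formGrid (hsymm : ∀ y, (𝒜 y).IsSymm) (N : ℕ) :
    IsHermitianForm fun U V : testSpace n => formGrid P 𝒜 N U V where
  add_left U V W := by
    simp only [formGrid_eq_sum]
    rw [← mul_add, ← Finset.sum_add_distrib]
    congr 1
    refine Finset.sum_congr rfl fun j _ => ?_
    have h := projGrad_add P U.2 V.2 (gridPoint j)
    rw [Submodule.coe_add, ContinuousMap.coe_add, h, matForm_add_left, Pi.add_apply]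
    ring
  smul_left c U V := by
    simp only [formGrid_eq_sum]
    rw [mul_left_comm, Finset.mul_sum _ _ c]
    refine congrArg _ (Finset.sum_congr rfl fun j _ => ?_)
    have h := projGrad_smul P c U.2 (gridPoint j)
    rw [Submodule.coe_smul, ContinuousMap.coe_smul, h, matForm_smul_left, Pi.smul_apply,
      smul_eq_mul]
    ring
  symm U V := by
    simp only [formGrid_eq_sum, map_mul, map_sum, map_add, matForm_conj (hsymm _), map_div₀,
      map_one, map_pow, map_natCast, Complex.conj_conj, mul_comm]

theorem IsHermitianForm.comp {E F : Type*} [AddCommGroup E] [Module ℂ E] [AddCommGroup F]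
    [Module ℂ F] {a : E → E → ℂ} (ha : IsHermitianForm a) (f : F →ₗ[ℂ] E) :
    IsHermitianForm fun x y => a (f x) (f y) where
  add_left x y z := (congrArg (fun u => a u (f z)) (f.map_add x y)).trans (ha.add_left _ _ _)
  smul_left c x y := (congrArg (fun u => a u (f y)) (f.map_smul c x)).trans (ha.smul_left _ _ _)
  symm _ _ := ha.symm _ _

/-- By exactness the norm of $H^1_P$ is itself a grid sum, so it can be compared with $a_p$ point by
point, with constants independent of `N`. -/
theorem norm_sq_embed {N : ℕ} (hN : 0 < N) {φ : testSpace n}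
    (hφ : (φ : C(Torus n, ℂ)) ∈ trigSpace n N) :
    ‖embed P φ‖ ^ 2 = 1 / (N : ℝ) ^ n * ∑ j : Fin n → Fin N,
      (∑ l, ‖projGrad P φ (gridPoint j) l‖ ^ 2 + ‖(φ : C(Torus n, ℂ)) (gridPoint j)‖ ^ 2) := by
  rw [norm_sq_H1P, toL2_embed, ← innerGrid_self_re_eq_norm_sq hN hφ, innerGrid_self_re]
  simp only [weakGrad_embed]
  have h : ∀ l, ‖contToL2 n (testGrad P l φ)‖ ^ 2
      = 1 / (N : ℝ) ^ n * ∑ j : Fin n → Fin N, ‖projGrad P φ (gridPoint j) l‖ ^ 2 := by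
    intro l
    rw [← innerGrid_self_re_eq_norm_sq hN (testGrad_mem_trigSpace P l hφ), innerGrid_self_re]
    rfl
  simp only [h]
  rw [← Finset.mul_sum, Finset.sum_comm, Finset.sum_add_distrib]
  ring

theorem formGrid_self_re (N : ℕ) (U : Torus n → ℂ) :
    (formGrid P 𝒜 N U U).re = 1 / (N : ℝ) ^ n * ∑ j : Fin n → Fin N,
      ((matForm (𝒜 (gridPoint j)) (projGrad P U (gridPoint j)) (projGrad P U (gridPoint j))).re
        + ‖U (gridPoint j)‖ ^ 2) := by
  have h : (1 / (N : ℂ) ^ n) = ((1 / (N : ℝ) ^ n : ℝ) : ℂ) := by push_cast; rfl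
  rw [formGrid_eq_sum, h, Complex.re_ofReal_mul, Complex.re_sum]
  simp only [Complex.add_re, Complex.mul_conj, Complex.normSq_eq_norm_sq, Complex.ofReal_re]

/-- On `V^N` the discrete form is equivalent to the square of the norm of `H¹_P`, uniformly
in `N`. -/
theorem formGrid_bounds {C₀ C₁ : ℝ} (hell : ∀ (y : Torus n) (ξ : Fin d → ℝ),
      C₀ * (ξ ⬝ᵥ ξ) ≤ ξ ⬝ᵥ (𝒜 y *ᵥ ξ) ∧ ξ ⬝ᵥ (𝒜 y *ᵥ ξ) ≤ C₁ * (ξ ⬝ᵥ ξ)) {N : ℕ} (hN : 0 < N)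
    {φ : testSpace n} (hφ : (φ : C(Torus n, ℂ)) ∈ trigSpace n N) :
    min C₀ 1 * ‖embed P φ‖ ^ 2 ≤ (formGrid P 𝒜 N φ φ).re ∧
      (formGrid P 𝒜 N φ φ).re ≤ max C₁ 1 * ‖embed P φ‖ ^ 2 := by
  have hpos : (0 : ℝ) ≤ 1 / (N : ℝ) ^ n := by positivity
  rw [norm_sq_embed P hN hφ, formGrid_self_re, mul_left_comm, mul_left_comm (max C₁ 1),
    Finset.mul_sum _ _ (min C₀ 1), Finset.mul_sum _ _ (max C₁ 1)]
  have hb := fun j : Fin n → Fin N =>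
    matForm_self_bounds (hell (gridPoint j)) (projGrad P φ (gridPoint j))
  constructor
  · refine mul_le_mul_of_nonneg_left (Finset.sum_le_sum fun j _ => ?_) hpos
    rw [mul_add]
    refine add_le_add (le_trans ?_ (hb j).1) ?_
    · exact mul_le_mul_of_nonneg_right (min_le_left _ _)
        (Finset.sum_nonneg fun l _ => sq_nonneg _)
    · exact mul_le_of_le_one_left (sq_nonneg _) (min_le_right _ _)
  · refine mul_le_mul_of_nonneg_left (Finset.sum_le_sum fun j _ => ?_) hpos
    rw [mul_add]
    refine add_le_add (le_trans (hb j).2 ?_) ?_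
    · exact mul_le_mul_of_nonneg_right (le_max_left _ _)
        (Finset.sum_nonneg fun l _ => sq_nonneg _)
    · exact le_mul_of_one_le_left (sq_nonneg _) (le_max_right _ _)

theorem norm_embed_pos {φ : testSpace n} (hφ : φ ≠ 0) : 0 < ‖embed P φ‖ := by
  have h : contToL2 n φ ≠ 0 := fun h0 => hφ <| Subtype.ext <|
    ContinuousMap.toLp_injective (E := ℂ) (p := 2) (𝕜 := ℂ) (torusMeasure n)
      (h0.trans (map_zero _).symm)
  exact (norm_pos_iff.2 h).trans_le (norm_toL2_le (embed P φ))

theorem formGrid_pos {C₀ C₁ : ℝ} (hC₀ : 0 < C₀) (hell : ∀ (y : Torus n) (ξ : Fin d → ℝ),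
      C₀ * (ξ ⬝ᵥ ξ) ≤ ξ ⬝ᵥ (𝒜 y *ᵥ ξ) ∧ ξ ⬝ᵥ (𝒜 y *ᵥ ξ) ≤ C₁ * (ξ ⬝ᵥ ξ)) {N : ℕ} (hN : 0 < N)
    (U : trigSpace n N) (hU : U ≠ 0) :
    0 < (formGrid P 𝒜 N (trigIncl n N U : C(Torus n, ℂ)) (trigIncl n N U : C(Torus n, ℂ))).re := by
  have hne : trigIncl n N U ≠ 0 := fun h =>
    hU ((Submodule.inclusion_injective (trigSpace_le_testSpace n N)) (h.trans (map_zero _).symm))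
  refine lt_of_lt_of_le ?_ (formGrid_bounds P hell hN (φ := trigIncl n N U) U.2).1
  exact mul_pos (lt_min hC₀ one_pos) (pow_pos (norm_embed_pos P hne) 2)

theorem isHermitianForm_innerGrid_trigSpace (n N : ℕ) :
    IsHermitianForm fun F G : trigSpace n N => innerGrid N (F : C(Torus n, ℂ)) (G : C(Torus n, ℂ)) :=
  (isHermitianForm_innerGrid n N).comp (trigSpace n N).subtype

theorem isHermitianForm_formGrid_trigSpace (hsymm : ∀ y, (𝒜 y).IsSymm) (N : ℕ) :
    IsHermitianForm fun F G : trigSpace n N =>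
      formGrid P 𝒜 N (F : C(Torus n, ℂ)) (G : C(Torus n, ℂ)) :=
  (isHermitianForm_formGrid P hsymm N).comp (trigIncl n N)

theorem existsUnique_isDiscreteSolutionOperator {C₀ C₁ : ℝ} (hC₀ : 0 < C₀)
    (hsymm : ∀ y, (𝒜 y).IsSymm) (hell : ∀ (y : Torus n) (ξ : Fin d → ℝ),
      C₀ * (ξ ⬝ᵥ ξ) ≤ ξ ⬝ᵥ (𝒜 y *ᵥ ξ) ∧ ξ ⬝ᵥ (𝒜 y *ᵥ ξ) ≤ C₁ * (ξ ⬝ᵥ ξ)) {N : ℕ} (hN : 0 < N) :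
    ∃! KN : Module.End ℂ (trigSpace n N), IsDiscreteSolutionOperator P 𝒜 N KN :=
  (isHermitianForm_formGrid_trigSpace P hsymm N).existsUnique_solution
    (formGrid_pos P hC₀ hell hN) (isHermitianForm_innerGrid_trigSpace n N)

/-- Both sides equal $(F,G)_N$, which is hermitian. This symmetry gives access to the residual
estimate. -/
theorem IsDiscreteSolutionOperator.symm {N : ℕ} (hsymm : ∀ y, (𝒜 y).IsSymm)
    {KN : Module.End ℂ (trigSpace n N)} (h : IsDiscreteSolutionOperator P 𝒜 N KN)
    (F G : trigSpace n N) :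
    formGrid P 𝒜 N (KN F : C(Torus n, ℂ)) (G : C(Torus n, ℂ))
      = formGrid P 𝒜 N (F : C(Torus n, ℂ)) (KN G : C(Torus n, ℂ)) := by
  have h1 := (isHermitianForm_formGrid_trigSpace P hsymm N).symm (KN G) F
  refine (h F G).trans (Eq.trans ?_ h1)
  rw [h G F, innerGrid_conj]

/-! ### Consistency of the two forms and convergence -/

/-- The `j`-th component of `𝒜 P∇φ` as a continuous function. -/
def fluxC (h𝒜 : Continuous 𝒜) (φ : testSpace n) (j : Fin d) : C(Torus n, ℂ) :=
  ∑ l, entry h𝒜 j l * testGrad P l φ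

theorem fluxC_apply (h𝒜 : Continuous 𝒜) (φ : testSpace n) (j : Fin d) (y : Torus n) :
    fluxC P h𝒜 φ j y = ∑ l, (𝒜 y j l : ℂ) * projGrad P φ y l := by
  simp only [fluxC, ContinuousMap.sum_apply, ContinuousMap.mul_apply]
  rfl

theorem formGrid_eq_fluxC (h𝒜 : Continuous 𝒜) (N : ℕ) (φ ψ : testSpace n) :
    formGrid P 𝒜 N φ ψ
      = ∑ j, innerGrid N (fluxC P h𝒜 φ j) (testGrad P j ψ)
        + innerGrid N (φ : C(Torus n, ℂ)) (ψ : C(Torus n, ℂ)) := by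
  rw [formGrid]
  congr 1
  refine Finset.sum_congr rfl fun j _ => ?_
  congr 1
  funext y
  exact (fluxC_apply P h𝒜 φ j y).symm

theorem formA_embed (h𝒜 : Continuous 𝒜) (φ ψ : testSpace n) :
    formA P 𝒜 (embed P φ) (embed P ψ)
      = ∑ j, innerL2 (fluxC P h𝒜 φ j) (testGrad P j ψ)
        + innerL2 (φ : C(Torus n, ℂ)) (ψ : C(Torus n, ℂ)) := by
  rw [formA]
  congr 1
  · refine Finset.sum_congr rfl fun j _ => integral_congr_ae ?_
    have h1 := ae_all_iff.2 fun l => coeFn_contToL2 (testGrad P l φ)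
    filter_upwards [h1, coeFn_contToL2 (testGrad P j ψ)] with y h1 h2
    simp only [weakGrad_embed]
    rw [h2, fluxC_apply]
    congr 1
    exact Finset.sum_congr rfl fun l _ => by rw [h1 l]; rfl
  · refine integral_congr_ae ?_
    filter_upwards [coeFn_contToL2 (φ : C(Torus n, ℂ)), coeFn_contToL2 (ψ : C(Torus n, ℂ))]
      with y h1 h2
    simp only [toL2_embed]
    rw [h1, h2]

/-- For fixed `φ` the flux is a fixed continuous function, so its quadrature error is small
uniformly in `ψ`. The factor `d` counts components; the zeroth-order terms agree exactly. -/
theorem eventually_norm_formA_sub_formGrid_le (h𝒜 : Continuous 𝒜) {φ : testSpace n}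
    (hφ : φ ∈ trigPoly n) {δ : ℝ} (hδ : 0 < δ) :
    ∀ᶠ N in atTop, ∀ ψ : testSpace n, (ψ : C(Torus n, ℂ)) ∈ trigSpace n N →
      ‖formA P 𝒜 (embed P φ) (embed P ψ) - formGrid P 𝒜 N φ ψ‖ ≤ d * δ * ‖embed P ψ‖ := by
  have h := eventually_all.2 fun j =>
    eventually_norm_innerL2_sub_innerGrid_le (fluxC P h𝒜 φ j) hδ
  filter_upwards [h, eventually_coe_mem_trigSpace hφ, eventually_gt_atTop 0] with N h hφN hN ψ hψ
  rw [formA_embed P h𝒜, formGrid_eq_fluxC P h𝒜, innerGrid_eq_innerL2 hN hφN hψ,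
    add_sub_add_right_eq_sub, ← Finset.sum_sub_distrib]
  have hj : ∀ j ∈ Finset.univ, ‖innerL2 (fluxC P h𝒜 φ j) (testGrad P j ψ)
      - innerGrid N (fluxC P h𝒜 φ j) (testGrad P j ψ)‖ ≤ δ * ‖embed P ψ‖ := fun j _ =>
    (h j _ (testGrad_mem_trigSpace P j hψ)).trans
      (mul_le_mul_of_nonneg_left (norm_weakGrad_le (embed P ψ) j) hδ.le)
  refine (norm_sum_le_of_le _ hj).trans_eq ?_
  rw [Finset.sum_const, Finset.card_univ, Fintype.card_fin, nsmul_eq_mul, mul_assoc]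

theorem norm_formA_sub_le (h𝒜 : Continuous 𝒜) :
    ∃ C : ℝ, 0 ≤ C ∧ ∀ U U' V : H1P P,
      ‖formA P 𝒜 U V - formA P 𝒜 U' V‖ ≤ C * ‖U - U'‖ * ‖V‖ := by
  refine ⟨‖formOp P h𝒜‖, ContinuousLinearMap.opNorm_nonneg _, fun U U' V => ?_⟩
  have h1 := inner_sub_right (𝕜 := ℂ) (E := H1P P) V (formOp P h𝒜 U) (formOp P h𝒜 U')
  rw [← inner_formOp_eq_formA P h𝒜, ← inner_formOp_eq_formA P h𝒜, ← h1, ← map_sub]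
  exact ((norm_inner_le_norm (𝕜 := ℂ) (E := H1P P) _ _).trans
    (mul_le_mul_of_nonneg_left ((formOp P h𝒜).le_opNorm _) (norm_nonneg _))).trans_eq
    (mul_comm _ _)

/-- The discrete solution operators converge strongly to the solution operator. -/
theorem eventually_norm_discreteSolution_sub_le (h𝒜 : Continuous 𝒜) {C₀ C₁ : ℝ} (hC₀ : 0 < C₀)
    (hsymm : ∀ y, (𝒜 y).IsSymm) (hell : ∀ (y : Torus n) (ξ : Fin d → ℝ),
      C₀ * (ξ ⬝ᵥ ξ) ≤ ξ ⬝ᵥ (𝒜 y *ᵥ ξ) ∧ ξ ⬝ᵥ (𝒜 y *ᵥ ξ) ≤ C₁ * (ξ ⬝ᵥ ξ))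
    {K : H1P P →L[ℂ] H1P P} (hK : IsSolutionOperator P 𝒜 K)
    {KN : ∀ N : ℕ, Module.End ℂ (trigSpace n N)}
    (hKN : ∀ N : ℕ, 0 < N → IsDiscreteSolutionOperator P 𝒜 N (KN N))
    {φ : testSpace n} (hφ : φ ∈ trigPoly n) {ε : ℝ} (hε : 0 < ε) :
    ∀ᶠ N in atTop, ∀ F : trigSpace n N, (F : C(Torus n, ℂ)) = φ →
      ‖embed P (trigIncl n N (KN N F)) - K (embed P φ)‖ ≤ ε := by
  obtain ⟨C, hC, hCb⟩ := norm_formA_sub_le P h𝒜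
  set c := min C₀ 1 with hc
  have hcpos : 0 < c := lt_min hC₀ one_pos
  have hden : 0 < (C + d) / c + 1 := by positivity
  -- The final error is $(C+d)\delta/c$ for $K_N\varphi-v$ plus $\delta$ for $v-K\varphi$.
  set δ := ε / ((C + d) / c + 1) with hδ
  have hδpos : 0 < δ := div_pos hε hden
  obtain ⟨v, hv, hvlt⟩ := exists_trigPoly_near P (K (embed P φ)) hδpos
  filter_upwards [eventually_norm_formA_sub_formGrid_le P h𝒜 hv hδpos,
    eventually_coe_mem_trigSpace hφ, eventually_coe_mem_trigSpace hv,
    eventually_gt_atTop 0] with N hcons hφN hvN hN F hF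
  set u := trigIncl n N (KN N F) with hu
  have huN : (u : C(Torus n, ℂ)) ∈ trigSpace n N := (KN N F).2
  set w := u - v with hw
  have hwN : (w : C(Torus n, ℂ)) ∈ trigSpace n N := Submodule.sub_mem _ huN hvN
  -- The discrete and the continuous problem share their right-hand side, since
  -- $(\varphi,w)_N=(\varphi,w)$ on $V^N$.
  have h1 : formGrid P 𝒜 N u w = formA P 𝒜 (K (embed P φ)) (embed P w) := by
    have e1 := hKN N hN F ⟨w, hwN⟩
    refine e1.trans ?_
    rw [hK, hF, innerGrid_eq_innerL2 hN hφN hwN]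
    refine integral_congr_ae ?_
    filter_upwards [coeFn_contToL2 (φ : C(Torus n, ℂ)), coeFn_contToL2 (w : C(Torus n, ℂ))]
      with y h1 h2
    simp only [toL2_embed]
    rw [h1, h2]
  -- Strang splitting: approximation error of `v`, then consistency error of the form at `v`.
  have h2 : formGrid P 𝒜 N w w = (formA P 𝒜 (K (embed P φ)) (embed P w)
      - formA P 𝒜 (embed P v) (embed P w))
      + (formA P 𝒜 (embed P v) (embed P w) - formGrid P 𝒜 N v w) := by
    refine ((isHermitianForm_formGrid P hsymm N).sub_left u v w).trans ?_
    rw [h1]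
    ring
  have h3 : c * ‖embed P w‖ ^ 2 ≤ (C + d) * δ * ‖embed P w‖ := by
    refine (formGrid_bounds P hell hN hwN).1.trans ((Complex.re_le_norm _).trans ?_)
    rw [h2]
    refine (norm_add_le _ _).trans ((add_le_add (hCb _ _ _) (hcons w hwN)).trans ?_)
    rw [← add_mul, add_mul C]
    exact mul_le_mul_of_nonneg_right
      (add_le_add (mul_le_mul_of_nonneg_left hvlt.le hC) le_rfl) (norm_nonneg _)
  have h4 : ‖embed P w‖ ≤ (C + d) / c * δ := by
    rw [div_mul_eq_mul_div, le_div_iff₀ hcpos, mul_comm]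
    rcases (norm_nonneg (embed P w)).eq_or_lt with h0 | h0
    · rw [← h0, mul_zero]
      positivity
    · refine le_of_mul_le_mul_right (le_trans (le_of_eq ?_) h3) h0
      ring
  have h5 : embed P u - K (embed P φ) = embed P w - (K (embed P φ) - embed P v) := by
    rw [hw, map_sub]
    abel
  rw [h5]
  refine (norm_sub_le _ _).trans ((add_le_add h4 hvlt.le).trans_eq ?_)
  rw [hδ]
  field_simp

/-- For large `N` an approximate eigenvector of `K` has residual at most $2\varepsilon\|\varphi\|$
under $K_N$; the residual estimate in the $a_p$ norm turns this into a nearby eigenvalue. -/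
theorem tendsto_infEDist_spectrum (h𝒜 : Continuous 𝒜) {C₀ C₁ : ℝ} (hC₀ : 0 < C₀)
    (hsymm : ∀ y, (𝒜 y).IsSymm) (hell : ∀ (y : Torus n) (ξ : Fin d → ℝ),
      C₀ * (ξ ⬝ᵥ ξ) ≤ ξ ⬝ᵥ (𝒜 y *ᵥ ξ) ∧ ξ ⬝ᵥ (𝒜 y *ᵥ ξ) ≤ C₁ * (ξ ⬝ᵥ ξ))
    {K : H1P P →L[ℂ] H1P P} (hK : IsSolutionOperator P 𝒜 K)
    {KN : ∀ N : ℕ, Module.End ℂ (trigSpace n N)}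
    (hKN : ∀ N : ℕ, 0 < N → IsDiscreteSolutionOperator P 𝒜 N (KN N))
    {γ : ℂ} (hγ : γ ∈ spectrum ℂ K) :
    Tendsto (fun N : ℕ => Metric.infEDist γ (spectrum ℂ (KN N))) atTop (𝓝 0) := by
  rw [ENNReal.tendsto_nhds_zero]
  intro ρ hρ
  obtain ⟨r, hr, hrρ⟩ : ∃ r : ℝ, 0 < r ∧ ENNReal.ofReal r ≤ ρ := by
    rcases eq_or_ne ρ ⊤ with rfl | hρ'
    · exact ⟨1, one_pos, le_top⟩
    · exact ⟨ρ.toReal, ENNReal.toReal_pos hρ.ne' hρ', ENNReal.ofReal_toReal_le⟩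
  set c := min C₀ 1 with hc
  have hcpos : 0 < c := lt_min hC₀ one_pos
  set M := max C₁ 1 with hM
  have hMpos : 0 < M := one_pos.trans_le (le_max_right _ _)
  -- Chosen so that $M(2\varepsilon)^2=r^2c$, which absorbs the equivalence constants between $a_p$
  -- and the norm.
  set ε := r * Real.sqrt (c / M) / 2 with hε
  have hεpos : 0 < ε := by positivity
  obtain ⟨φ, hφ, hlt⟩ := exists_trigPoly_approx_eigenvector P h𝒜 hC₀ hsymm hell hK hγ hεpos
  have hnorm : 0 < ‖embed P φ‖ := by
    by_contra h
    have h0 := (norm_nonneg _).trans_lt hlt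
    nlinarith [norm_nonneg (embed P φ)]
  filter_upwards [eventually_norm_discreteSolution_sub_le P h𝒜 hC₀ hsymm hell hK hKN hφ
    (mul_pos hεpos hnorm), eventually_coe_mem_trigSpace hφ, eventually_gt_atTop 0]
    with N hconv hφN hN
  set F : trigSpace n N := ⟨φ, hφN⟩ with hF
  have hF0 : F ≠ 0 := by
    intro h0
    have : φ = 0 := Subtype.ext (congrArg (fun G : trigSpace n N => (G : C(Torus n, ℂ))) h0)
    rw [this, map_zero, norm_zero] at hnorm
    exact hnorm.false
  obtain ⟨μ, hμ, hle⟩ := (isHermitianForm_formGrid_trigSpace P hsymm N).exists_mem_spectrum_near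
    (formGrid_pos P hC₀ hell hN) ((hKN N hN).symm P hsymm) γ hF0
  have hb1 := (formGrid_bounds P hell hN hφN).1
  have hb2 := (formGrid_bounds P hell hN (φ := trigIncl n N (KN N F - γ • F))
    (KN N F - γ • F).2).2
  have hres : ‖embed P (trigIncl n N (KN N F - γ • F))‖ ≤ 2 * ε * ‖embed P φ‖ := by
    have e1 : embed P (trigIncl n N (KN N F - γ • F))
        = (embed P (trigIncl n N (KN N F)) - K (embed P φ))
          + (K (embed P φ) - γ • embed P φ) := by
      have e2 : trigIncl n N F = φ := rfl
      rw [map_sub, map_sub, map_smul, map_smul, e2]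
      abel
    rw [e1]
    refine (norm_add_le _ _).trans ((add_le_add (hconv F rfl) hlt.le).trans_eq ?_)
    ring
  have hfin : ‖γ - μ‖ ^ 2 * (c * ‖embed P φ‖ ^ 2) ≤ M * (2 * ε * ‖embed P φ‖) ^ 2 :=
    (mul_le_mul_of_nonneg_left hb1 (sq_nonneg _)).trans (hle.trans (hb2.trans
      (mul_le_mul_of_nonneg_left (pow_le_pow_left₀ (norm_nonneg _) hres 2) hMpos.le)))
  have hsq : (2 * ε) ^ 2 = r ^ 2 * (c / M) := by
    rw [hε, mul_div_cancel₀ _ (two_ne_zero), mul_pow, Real.sq_sqrt (by positivity)]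
  have hdist : ‖γ - μ‖ ≤ r := by
    refine le_of_sq_le_sq ?_ hr.le
    rw [mul_pow, hsq] at hfin
    have e3 : M * (r ^ 2 * (c / M) * ‖embed P φ‖ ^ 2) = r ^ 2 * (c * ‖embed P φ‖ ^ 2) := by
      field_simp
    rw [e3] at hfin
    exact le_of_mul_le_mul_right hfin (by positivity)
  refine (Metric.infEDist_le_edist_of_mem hμ).trans (le_trans ?_ hrρ)
  rw [edist_dist, dist_eq_norm]
  exact ENNReal.ofReal_le_ofReal hdist

end FormGrid

end QEO

end

/-- `Metric.infEDist` to an empty set is `⊤`, so the limit cannot hold through empty spectra. `KN 0`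
is arbitrary, which a limit at infinity does not see. -/
theorem mainTheorem1 (d n : ℕ) (P : Matrix (Fin d) (Fin n) ℝ) (hP : QEO.IsProjectionMatrix P)
    (𝒜 : QEO.Torus n → Matrix (Fin d) (Fin d) ℝ) (h𝒜 : Continuous 𝒜)
    (α : (Fin d → ℝ) → Matrix (Fin d) (Fin d) ℝ)
    (hα : ∀ x : Fin d → ℝ, α x = 𝒜 (QEO.toTorus (Pᵀ *ᵥ x)))
    (hsymm : ∀ x : Fin d → ℝ, (α x).IsSymm)
    (C₀ C₁ : ℝ) (hC₀ : 0 < C₀) (hC₁ : 0 < C₁)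
    (hell : ∀ x ξ : Fin d → ℝ,
      C₀ * (ξ ⬝ᵥ ξ) ≤ ξ ⬝ᵥ (α x *ᵥ ξ) ∧ ξ ⬝ᵥ (α x *ᵥ ξ) ≤ C₁ * (ξ ⬝ᵥ ξ)) :
    (∃! K : QEO.H1P P →L[ℂ] QEO.H1P P, QEO.IsSolutionOperator P 𝒜 K) ∧
    (∀ N : ℕ, 0 < N →
      ∃! KN : Module.End ℂ (QEO.trigSpace n N), QEO.IsDiscreteSolutionOperator P 𝒜 N KN) ∧
    ∀ (K : QEO.H1P P →L[ℂ] QEO.H1P P) (KN : ∀ N : ℕ, Module.End ℂ (QEO.trigSpace n N)),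
      QEO.IsSolutionOperator P 𝒜 K →
      (∀ N : ℕ, 0 < N → QEO.IsDiscreteSolutionOperator P 𝒜 N (KN N)) →
      ∀ γ ∈ spectrum ℂ K,
        Tendsto (fun N : ℕ => Metric.infEDist γ (spectrum ℂ (KN N))) atTop (𝓝 0) := by
 
  -- The hypotheses speak only of points on the orbit, while integrals and grid points involve the
  -- whole torus.
  have h := hP.parent_bounds h𝒜 (C₀ := C₀) (C₁ := C₁) (fun x => hα x ▸ hsymm x)
    (fun x ξ => hα x ▸ hell x ξ)
  exact ⟨QEO.existsUnique_isSolutionOperator P h𝒜 hC₀ fun y => (h y).2,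
    fun N hN => QEO.existsUnique_isDiscreteSolutionOperator P hC₀ (fun y => (h y).1)
      (fun y => (h y).2) hN,
    fun K KN hK hKN γ hγ => QEO.tendsto_infEDist_spectrum P h𝒜 hC₀ (fun y => (h y).1)
      (fun y => (h y).2) hK hKN hγ⟩
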